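/- Let $A,B\subset\mathbb{R}^n$ be open sets with smooth boundaries, that is, near each of its boundary points each of the sets is of the form $\{\varphi>0\}$ for a $C^\infty$ function $\varphi$ with nowhere vanishing gradient. Suppose that $A\cap B$ is nonempty and bounded. For $\varepsilon>0$ put \[(\partial A\cap\partial B)_\varepsilon:=\{x\in\mathbb{R}^n:\operatorname{dist}(x,\partial A\cap\partial B)<\varepsilon\},\] which is the empty set if $\partial A\cap\partial B=\emptyset$. Then for every $\varepsilon>0$ there is an open set $\Omega\subset\mathbb{R}^n$ with smooth boundary such that \[(A\cap B)\setminus(\partial A\cap\partial B)_\varepsilon\subset\Omega\subset A\cap B.\] Moreover, let $\Gamma\subset\mathbb{R}^{n-1}$ be a convex cone (closed under multiplication by positive scalars) that is open or closed, is symmetric, i.e. invariant under permutations of the coordinates, and contains the positive cone $\Gamma_+=\{\kappa:\kappa_i>0\text{ for all }i\}$. If the principal curvatures $(\kappa_1,\dots,\kappa_{n-1})$ at every point of $\partial A$ and of $\partial B$ lie in $\Gamma$, then for every $\varepsilon>0$ the set $\Omega$ above can be chosen such that in addition the principal curvatures at every point of $\partial\Omega$ lie in $\Gamma$. Here the principal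 curvatures of the boundary of an open set are the eigenvalues of the shape operator $v\mapsto -D_v\nu$ on the tangent space, where $\nu$ is the inner unit normal, so that the boundary of a unit ball has principal curvatures $1$. -/

import Mathlib

open scoped ContDiff

noncomputable section

/-- `φ` is a smooth local defining function of `A` near `x`: on some open neighbourhood `U` of `x`,
`φ` is smooth with nowhere vanishing gradient and `A ∩ U = {y ∈ U | φ y > 0}`. -/
def IsLocalDefiningFunction {n : ℕ} (A : Set (EuclideanSpace ℝ (Fin n)))
    (x : EuclideanSpace ℝ (Fin n)) (φ : EuclideanSpace ℝ (Fin n) → ℝ) : Prop :=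
  ∃ U : Set (EuclideanSpace ℝ (Fin n)), IsOpen U ∧ x ∈ U ∧ ContDiffOn ℝ ∞ φ U ∧
    (∀ y ∈ U, gradient φ y ≠ 0) ∧ ∀ y ∈ U, y ∈ A ↔ 0 < φ y

/-- `∂A ∈ C^∞`: near each of its boundary points, `A` is the positivity set of a smooth function
without critical points (equivalently, the region on one side of a smooth graph). -/
def HasSmoothBoundary {n : ℕ} (A : Set (EuclideanSpace ℝ (Fin n))) : Prop :=
  ∀ x ∈ frontier A, ∃ φ : EuclideanSpace ℝ (Fin n) → ℝ, IsLocalDefiningFunction A x φ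

/-- The unit vector field `∇φ / |∇φ|`. If `φ` is a local defining function of `A`, its restriction
to `∂A` is the inner unit normal of `A`. -/
def unitNormalField {n : ℕ} (φ : EuclideanSpace ℝ (Fin n) → ℝ) (y : EuclideanSpace ℝ (Fin n)) :
    EuclideanSpace ℝ (Fin n) :=
  ‖gradient φ y‖⁻¹ • gradient φ y

/-- `κ` lists, with multiplicity and in some order, the principal curvatures of `∂A` at the
boundary point `x`: there is an orthonormal basis `e` of the tangent space of `∂A` at `x`
consisting of eigenvectors of the shape operator `v ↦ -Dν(x) v`, with eigenvalues `κ`, where `ν` is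
the inner unit normal. With this sign the unit sphere, as boundary of the unit ball, has principal
curvatures `1`. -/
def IsPrincipalCurvatures {n : ℕ} (A : Set (EuclideanSpace ℝ (Fin n)))
    (x : EuclideanSpace ℝ (Fin n)) (κ : Fin (n - 1) → ℝ) : Prop :=
  ∃ φ : EuclideanSpace ℝ (Fin n) → ℝ, IsLocalDefiningFunction A x φ ∧
    ∃ e : Fin (n - 1) → EuclideanSpace ℝ (Fin n), Orthonormal ℝ e ∧
      ∀ i, inner ℝ (gradient φ x) (e i) = 0 ∧
        -(fderiv ℝ (unitNormalField φ) x (e i)) = κ i • e i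

/-- The principal curvatures of `∂A` at every point of `∂A` lie in `Γ`. -/
def PrincipalCurvaturesIn {n : ℕ} (A : Set (EuclideanSpace ℝ (Fin n)))
    (Γ : Set (Fin (n - 1) → ℝ)) : Prop :=
  ∀ x ∈ frontier A, ∀ κ : Fin (n - 1) → ℝ, IsPrincipalCurvatures A x κ → κ ∈ Γ

/-- `Γ` is a symmetric, open or closed, convex cone in `ℝ^m` containing the positive cone
`{κ | κ_i > 0 for all i}`. -/
structure IsCurvatureCone {m : ℕ} (Γ : Set (Fin m → ℝ)) : Prop where
  isOpen_or_isClosed : IsOpen Γ ∨ IsClosed Γ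
  convex : Convex ℝ Γ
  smul_mem : ∀ c : ℝ, 0 < c → ∀ κ ∈ Γ, c • κ ∈ Γ
  symmetric : ∀ σ : Equiv.Perm (Fin m), ∀ κ ∈ Γ, κ ∘ σ ∈ Γ
  pos_mem : ∀ κ : Fin m → ℝ, (∀ i, 0 < κ i) → κ ∈ Γ

end

open Set Filter Topology Metric

/-! ### Curvature cones: monotonicity and averaging. -/

namespace IsCurvatureCone

variable {m : ℕ} {Γ : Set (Fin m → ℝ)}

/-! If neither set is the whole space, `A ∩ B` is the positivity set of `min f g`, where `f` and `g`
are `1 - exp (-c d)` for the signed distances `d` of `A` and `B`. The set `Ω` is the positivity set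
of a concave smoothing `smoothMin s f g ≤ min f g`, which equals the minimum once `|f - g| ≥ s`.
Outside the rounding zone `∂Ω` is locally `∂A` or `∂B`. Inside it, `smoothMin s f g ≤ 0` forces `f +
g ≤ s`; for small `s` both distances are then small, and compactness puts the point within `ε` of
`∂A ∩ ∂B`.

Curvature of `f` and `g`: the signed distance is smooth near the boundary
(`frontier_subset_distRegularSet`). If `y` is a foot point of `x`, then `d (x + v) ≤ d x + d (y +
v)` with equality at `v = 0`, so the Hessian at `x` is at most the one at `y`, where the principal
curvatures are known. The exponential adds `c ν ⊗ ν` with `c` above all these curvatures. As a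
result the diagonal of the negative Hessian lies in `Γ` for every orthonormal frame of `n - 1`
vectors, tangent or not (`hessian_expDist_mem`): by Parseval and Birkhoff it dominates an average of
permutations of the curvatures (`IsCurvatureCone.diagonal_mem`). Arbitrary frames are needed since
`∂Ω` need be tangent to no level set of `f` or `g`.

Curvature of `∂Ω`: by concavity and homogeneity, `smoothMin s f g` is touched from above by some `α
f + β g - γ s` with `α + β = 1`. As `s` is affine, it does not enter the Hessian. Locally `Ω` lies
where this majorant is nonnegative, so comparing second derivatives bounds the curvatures of `∂Ω`
from below by an element of `Γ` (`curvature_mem_of_affineSmoothMin`).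

Regularity of `∂Ω`: take `s x = q.2 + ⟪q.1, x⟫`. Since `γ > 0` inside the rounding zone, a critical
zero `x` together with the value `s x` determines `q`. Such pairs form a null set, because
`smoothMin` is strictly decreasing in `s`, and a differentiable map between spaces of equal
dimension keeps it null. Hence generic `q` work (`exists_regular_parameter`). -/

theorem add_mem (hΓ : IsCurvatureCone Γ) {κ κ' : Fin m → ℝ} (h : κ ∈ Γ) (h' : κ' ∈ Γ) :
    κ + κ' ∈ Γ := by
  have h2 := hΓ.smul_mem 2 two_pos _
    (hΓ.convex h h' (a := 1 / 2) (b := 1 / 2) (by norm_num) (by norm_num) (by norm_num))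
  convert h2 using 1
  ext i
  simp
  ring

/-- The difference of the tuples is only nonnegative, so a small `δ` makes it positive: an open cone
leaves room to subtract `δ` from `κ`, a closed one allows adding `δ` to `κ'` and passing to the
limit. -/
theorem mem_of_le (hΓ : IsCurvatureCone Γ) {κ κ' : Fin m → ℝ} (h : κ ∈ Γ) (hle : ∀ i, κ i ≤ κ' i) :
    κ' ∈ Γ := by
  rcases hΓ.isOpen_or_isClosed with ho | hc
  · have hcont : Continuous fun δ : ℝ => fun i => κ i - δ := by fun_prop
    have hev : ∀ᶠ δ : ℝ in 𝓝[>] 0, (fun i => κ i - δ) ∈ Γ := by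
      refine nhdsWithin_le_nhds (hcont.continuousAt.eventually_mem (ho.mem_nhds ?_))
      simpa using h
    obtain ⟨δ, hδ, hδ0⟩ := (hev.and self_mem_nhdsWithin).exists
    have hpos : (fun i => κ' i - κ i + δ) ∈ Γ :=
      hΓ.pos_mem _ fun i => by
        have := hle i
        have : 0 < δ := hδ0
        linarith
    convert hΓ.add_mem hδ hpos using 1
    ext i
    simp
  · have hcont : Continuous fun δ : ℝ => fun i => κ' i + δ := by fun_prop
    have hlim : Tendsto (fun δ : ℝ => fun i => κ' i + δ) (𝓝[>] 0) (𝓝 κ') := by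
      have := hcont.tendsto 0
      simp only [add_zero] at this
      exact this.mono_left nhdsWithin_le_nhds
    refine hc.mem_of_tendsto hlim ?_
    filter_upwards [self_mem_nhdsWithin] with δ hδ
    have hpos : (fun i => κ' i - κ i + δ) ∈ Γ :=
      hΓ.pos_mem _ fun i => by
        have := hle i
        have : 0 < δ := hδ
        linarith
    convert hΓ.add_mem h hpos using 1
    ext i
    simp
    ring

/-- Replacing entries of `κ ∈ Γ` by a number exceeding all of them and permuting stays in `Γ`. -/
theorem perm_option_mem (hΓ : IsCurvatureCone Γ) {κ : Fin m → ℝ} (h : κ ∈ Γ) {c : ℝ}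
    (hc : ∀ i, κ i ≤ c) (σ : Equiv.Perm (Option (Fin m))) :
    (fun i => (σ (some i)).elim c κ) ∈ Γ := by
  -- Short-circuiting `none` gives a permutation of `Fin m`; the permuted `κ` differs from the given
  -- tuple only at an index where `c` has replaced an entry.
  refine hΓ.mem_of_le (hΓ.symmetric (Equiv.removeNone σ) κ h) fun i => ?_
  cases hi : σ (some i) with
  | none => exact hc _
  | some k =>
    have := Equiv.removeNone_some σ ⟨k, hi⟩
    rw [hi] at this
    simp [Option.some_injective _ this]

/-- Birkhoff's theorem writes `M` as a convex combination of permutation matrices, which reduces the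
claim to `perm_option_mem`. -/
theorem doublyStochastic_mem (hΓ : IsCurvatureCone Γ) {κ : Fin m → ℝ} (h : κ ∈ Γ) {c : ℝ}
    (hc : ∀ i, κ i ≤ c) {M : Matrix (Option (Fin m)) (Option (Fin m)) ℝ}
    (hM : M ∈ doublyStochastic ℝ (Option (Fin m))) :
    (fun i => ∑ k, M (some i) k * k.elim c κ) ∈ Γ := by
  obtain ⟨w, hw, hw1, rfl⟩ := exists_eq_sum_perm_of_mem_doublyStochastic hM
  have := hΓ.convex.sum_mem (t := Finset.univ) (w := w)
    (z := fun σ i => (σ (some i)).elim c κ) (fun σ _ => hw σ) hw1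
    (fun σ _ => hΓ.perm_option_mem h hc σ)
  convert this using 1
  ext i
  simp only [Finset.sum_apply, Pi.smul_apply, smul_eq_mul, Matrix.sum_apply, Matrix.smul_apply,
    Finset.sum_mul]
  rw [Finset.sum_comm]
  refine Finset.sum_congr rfl fun σ _ => ?_
  simp [PEquiv.toMatrix_apply, Equiv.toPEquiv_apply]

end IsCurvatureCone

/-! ### Orthonormal frames and diagonal entries. -/

section Orthonormal

variable {E : Type*} [NormedAddCommGroup E] [InnerProductSpace ℝ E]

theorem Orthonormal.option {ι : Type*} {e : ι → E} (he : Orthonormal ℝ e) {u : E} (hu : ‖u‖ = 1)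
    (h : ∀ i, inner ℝ u (e i) = 0) : Orthonormal ℝ (fun o : Option ι => o.elim u e) := by
  constructor
  · rintro (_ | i)
    · exact hu
    · exact he.1 i
  · rintro (_ | i) (_ | j) hij
    · exact absurd rfl hij
    · exact h j
    · simpa [real_inner_comm] using h i
    · exact he.2 fun hh => hij (by rw [hh])

theorem Orthonormal.exists_unit_orthogonal [FiniteDimensional ℝ E] {ι : Type*} [Fintype ι]
    {e : ι → E} (hcard : Fintype.card ι < Module.finrank ℝ E) :
    ∃ u : E, ‖u‖ = 1 ∧ ∀ i, inner ℝ u (e i) = 0 := by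
  have h1 : Module.finrank ℝ (Submodule.span ℝ (range e)) ≤ Fintype.card ι :=
    finrank_range_le_card e
  have h2 := Submodule.finrank_add_finrank_orthogonal (Submodule.span ℝ (range e))
  have h3 : 0 < Module.finrank ℝ (Submodule.span ℝ (range e))ᗮ := by omega
  have h4 : Nontrivial (Submodule.span ℝ (range e))ᗮ := Module.finrank_pos_iff.1 h3
  obtain ⟨u, hu⟩ := exists_norm_eq (Submodule.span ℝ (range e))ᗮ zero_le_one
  refine ⟨u, hu, fun i => ?_⟩
  rw [real_inner_comm]
  exact u.2 _ (Submodule.subset_span ⟨i, rfl⟩)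

/-- Diagonal entries of `∑ κ k • f k ⊗ f k + c • ν ⊗ ν`, with `f` an orthonormal basis of `νᗮ`, in
any orthonormal family of `m` vectors of an `(m + 1)`-dimensional space. -/
theorem IsCurvatureCone.diagonal_mem [FiniteDimensional ℝ E] {m : ℕ} {Γ : Set (Fin m → ℝ)}
    (hΓ : IsCurvatureCone Γ) (hdim : Module.finrank ℝ E = m + 1) {κ : Fin m → ℝ} (h : κ ∈ Γ)
    {c : ℝ} (hc : ∀ i, κ i ≤ c) {f e : Fin m → E} (hf : Orthonormal ℝ f) (he : Orthonormal ℝ e)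
    {ν : E} (hν : ‖ν‖ = 1) (hνf : ∀ i, inner ℝ ν (f i) = 0) :
    (fun i => ∑ k, κ k * inner ℝ (f k) (e i) ^ 2 + c * inner ℝ ν (e i) ^ 2) ∈ Γ := by
  obtain ⟨u, hu, hue⟩ := Orthonormal.exists_unit_orthogonal (e := e) (by simp [hdim])
  have hcard : Fintype.card (Option (Fin m)) = Module.finrank ℝ E := by simp [hdim]
  have hbasis : ∀ {g : Option (Fin m) → E}, Orthonormal ℝ g →
      ∃ b : OrthonormalBasis (Option (Fin m)) ℝ E, ⇑b = g := fun {g} hg =>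
    ⟨(basisOfOrthonormalOfCardEqFinrank hg hcard).toOrthonormalBasis (by simpa using hg), by simp⟩
  obtain ⟨bf, hbf⟩ := hbasis (hf.option hν hνf)
  obtain ⟨be, hbe⟩ := hbasis (he.option hu hue)
  -- Squared transition coefficients between two orthonormal bases are doubly stochastic by
  -- Parseval; for this both frames were completed by one vector.
  have hM : Matrix.of (fun i k => inner ℝ (bf k) (be i) ^ 2) ∈
      doublyStochastic ℝ (Option (Fin m)) := by
    rw [mem_doublyStochastic_iff_sum]
    refine ⟨fun i k => sq_nonneg _, fun i => ?_, fun k => ?_⟩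
    · have := bf.sum_sq_norm_inner_right (be i)
      simpa [Real.norm_eq_abs, sq_abs] using this
    · have := be.sum_sq_norm_inner_left (bf k)
      simpa [Real.norm_eq_abs, sq_abs] using this
  convert hΓ.doublyStochastic_mem h hc hM using 1
  ext i
  simp [Fintype.sum_option, hbf, hbe]
  rw [add_comm, mul_comm c]
  congr 1
  exact Finset.sum_congr rfl fun k _ => mul_comm _ _

end Orthonormal

/-! ### Second-order comparison of functions and of their positivity sets. -/

section SecondOrder

theorem eventually_pos_of_hasDerivAt_pos {g : ℝ → ℝ} {k : ℝ} (hg : HasDerivAt g k 0)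
    (h0 : g 0 = 0) (hk : 0 < k) : ∀ᶠ τ in 𝓝[>] (0 : ℝ), 0 < g τ := by
  have h1 := hasDerivAt_iff_tendsto_slope.1 hg
  have h2 := (h1.mono_left (nhdsWithin_mono 0 fun τ (hτ : 0 < τ) => hτ.ne')).eventually_const_lt hk
  filter_upwards [h2, self_mem_nhdsWithin] with τ hτ hpos
  rw [slope_def_field, h0, sub_zero, sub_zero] at hτ
  exact (div_pos_iff_of_pos_right hpos).1 hτ

/-- Subtracting `k / 4 * τ ^ 2` leaves a positive second derivative, so `0` is still a local
minimum; this upgrades the weak inequality of the second derivative test to a strict one. -/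
theorem eventually_pos_of_second_deriv_pos {g g' : ℝ → ℝ} {k : ℝ}
    (hg : ∀ᶠ τ in 𝓝 (0 : ℝ), HasDerivAt g (g' τ) τ) (hg' : HasDerivAt g' k 0)
    (h0 : g 0 = 0) (h0' : g' 0 = 0) (hk : 0 < k) : ∀ᶠ τ in 𝓝[>] (0 : ℝ), 0 < g τ := by
  have hf : ∀ᶠ τ in 𝓝 (0 : ℝ),
      HasDerivAt (fun τ => g τ - k / 4 * τ ^ 2) (g' τ - k / 2 * τ) τ := by
    filter_upwards [hg] with τ hτ
    refine (hτ.fun_sub ((hasDerivAt_pow 2 τ).const_mul (k / 4))).congr_deriv ?_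
    simp only [Nat.cast_ofNat, Nat.add_one_sub_one, pow_one]
    ring
  have hd : deriv (fun τ => g τ - k / 4 * τ ^ 2) =ᶠ[𝓝 0] fun τ => g' τ - k / 2 * τ :=
    hf.mono fun τ hτ => hτ.deriv
  have hdd : HasDerivAt (fun τ => g' τ - k / 2 * τ) (k - k / 2) 0 := by
    simpa using hg'.fun_sub ((hasDerivAt_id (0 : ℝ)).const_mul (k / 2))
  have hmin := isLocalMin_of_deriv_deriv_pos (f := fun τ => g τ - k / 4 * τ ^ 2) (x₀ := 0)
    (by rw [hd.deriv_eq, hdd.deriv]; linarith) (by rw [hd.eq_of_nhds]; simp [h0'])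
    hf.self_of_nhds.continuousAt
  filter_upwards [nhdsWithin_le_nhds hmin, self_mem_nhdsWithin] with τ hτ hpos
  have hpos : 0 < τ := hpos
  simp only [h0] at hτ
  have : 0 < k / 4 * τ ^ 2 := by positivity
  linarith

variable {E : Type*} [NormedAddCommGroup E] [NormedSpace ℝ E]

/-- The quadratic term lets a curve with tangential velocity `v` be bent in a transversal direction
`w`, which is what second-order information on a level set requires. -/
theorem hasDerivAt_parabola (x v w : E) (τ : ℝ) :
    HasDerivAt (fun τ : ℝ => x + τ • v + τ ^ 2 • w) (v + (2 * τ) • w) τ := by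
  have h1 : HasDerivAt (fun τ : ℝ => τ • v) v τ := by
    simpa using (hasDerivAt_id τ).smul_const v
  have h2 : HasDerivAt (fun τ : ℝ => τ ^ 2 • w) ((2 * τ) • w) τ := by
    simpa using (hasDerivAt_pow 2 τ).smul_const w
  simpa using (h1.const_add x).fun_add h2

variable {f h : E → ℝ} {x y : E}

theorem ContDiffAt.eventually_hasDerivAt_parabola (hf : ContDiffAt ℝ 2 f x) (v w : E) :
    ∀ᶠ τ in 𝓝 (0 : ℝ), HasDerivAt (fun τ : ℝ => f (x + τ • v + τ ^ 2 • w))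
      (fderiv ℝ f (x + τ • v + τ ^ 2 • w) (v + (2 * τ) • w)) τ := by
  have h1 : ∀ᶠ z in 𝓝 x, DifferentiableAt ℝ f z :=
    (hf.eventually (by simp)).mono fun z hz => hz.differentiableAt (by simp)
  have h2 : Tendsto (fun τ : ℝ => x + τ • v + τ ^ 2 • w) (𝓝 0) (𝓝 x) := by
    simpa using (hasDerivAt_parabola x v w 0).continuousAt.tendsto
  filter_upwards [h2.eventually h1] with τ hτ
  exact hτ.hasFDerivAt.comp_hasDerivAt τ (hasDerivAt_parabola x v w τ)

theorem ContDiffAt.differentiableAt_fderiv (hf : ContDiffAt ℝ 2 f x) :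
    DifferentiableAt ℝ (fderiv ℝ f) x :=
  (hf.fderiv_right (m := 1) (by norm_num)).differentiableAt (by simp)

theorem ContDiffAt.hasDerivAt_fderiv_parabola (hf : ContDiffAt ℝ 2 f x) (v w : E) :
    HasDerivAt (fun τ : ℝ => fderiv ℝ f (x + τ • v + τ ^ 2 • w) (v + (2 * τ) • w))
      (fderiv ℝ (fderiv ℝ f) x v v + 2 * fderiv ℝ f x w) 0 := by
  have hx : x + (0 : ℝ) • v + (0 : ℝ) ^ 2 • w = x := by simp
  have h1 : HasDerivAt (fun τ : ℝ => fderiv ℝ f (x + τ • v + τ ^ 2 • w))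
      (fderiv ℝ (fderiv ℝ f) x (v + (2 * (0 : ℝ)) • w)) 0 := by
    refine HasFDerivAt.comp_hasDerivAt (x := (0 : ℝ)) ?_ (hasDerivAt_parabola x v w 0)
    rw [hx]
    exact hf.differentiableAt_fderiv.hasFDerivAt
  have h2 : HasDerivAt (fun τ : ℝ => v + (2 * τ) • w) ((2 : ℝ) • w) 0 := by
    have : HasDerivAt (fun τ : ℝ => 2 * τ) 2 0 := by
      simpa using (hasDerivAt_id (0 : ℝ)).const_mul 2
    simpa using (this.smul_const w).const_add v
  refine (h1.clm_apply h2).congr_deriv ?_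
  simp

/-- If the graph of `f` near `x` lies below that of `h` near `y` and touches it, then the first
derivatives agree. -/
theorem fderiv_eq_of_touching (hf : DifferentiableAt ℝ f x) (hh : DifferentiableAt ℝ h y)
    (hle : ∀ᶠ v in 𝓝 (0 : E), f (x + v) ≤ h (y + v)) (heq : f x = h y) :
    fderiv ℝ f x = fderiv ℝ h y := by
  have hmin : IsLocalMin (fun v => h (y + v) - f (x + v)) 0 := by
    filter_upwards [hle] with v hv
    simp [heq, hv]
  have h1 : HasFDerivAt (fun v => h (y + v) - f (x + v)) (fderiv ℝ h y - fderiv ℝ f x) 0 := by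
    have a1 : HasFDerivAt h (fderiv ℝ h y) (y + 0) := by simpa using hh.hasFDerivAt
    have a2 : HasFDerivAt f (fderiv ℝ f x) (x + 0) := by simpa using hf.hasFDerivAt
    have b : ∀ z : E, HasFDerivAt (fun v => z + v) (ContinuousLinearMap.id ℝ E) 0 := fun z =>
      (hasFDerivAt_id (0 : E)).const_add z
    exact (a1.comp (0 : E) (b y)).sub (a2.comp (0 : E) (b x))
  exact (sub_eq_zero.1 (hmin.hasFDerivAt_eq_zero h1)).symm

/-- If the graph of `f` near `x` lies below that of `h` near `y` and touches it, then the second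
derivatives are ordered. -/
theorem hessian_le_of_touching (hf : ContDiffAt ℝ 2 f x) (hh : ContDiffAt ℝ 2 h y)
    (hle : ∀ᶠ v in 𝓝 (0 : E), f (x + v) ≤ h (y + v)) (heq : f x = h y) (v : E) :
    fderiv ℝ (fderiv ℝ f) x v v ≤ fderiv ℝ (fderiv ℝ h) y v v := by
  by_contra! hlt
  have hd := fderiv_eq_of_touching (hf.differentiableAt (by simp)) (hh.differentiableAt (by simp))
    hle heq
  have h1 : ∀ᶠ τ in 𝓝[>] (0 : ℝ),
      0 < f (x + τ • v + τ ^ 2 • (0 : E)) - h (y + τ • v + τ ^ 2 • (0 : E)) := by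
    refine eventually_pos_of_second_deriv_pos (k := (fderiv ℝ (fderiv ℝ f) x v v +
      2 * fderiv ℝ f x 0) - (fderiv ℝ (fderiv ℝ h) y v v + 2 * fderiv ℝ h y 0))
      ((hf.eventually_hasDerivAt_parabola v 0).and (hh.eventually_hasDerivAt_parabola v 0) |>.mono
        fun τ hτ => hτ.1.sub hτ.2)
      ((hf.hasDerivAt_fderiv_parabola v 0).sub (hh.hasDerivAt_fderiv_parabola v 0)) ?_ ?_ ?_
    · simp [heq]
    · simp [hd]
    · simpa using hlt
  have h2 : Tendsto (fun τ : ℝ => τ • v) (𝓝[>] 0) (𝓝 0) := by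
    have : Continuous fun τ : ℝ => τ • v := by fun_prop
    simpa using (this.tendsto 0).mono_left nhdsWithin_le_nhds
  obtain ⟨τ, ha, hb⟩ := (h1.and (h2.eventually hle)).exists
  simp only [smul_zero, add_zero] at ha
  linarith

/-- If `{f > 0} ⊆ {h ≥ 0}` near the common zero `x`, the differentials are positively
proportional. -/
theorem exists_fderiv_eq_smul_of_pos_imp (hf : ContDiffAt ℝ 2 f x) (hh : ContDiffAt ℝ 2 h x)
    (hf0 : f x = 0) (hh0 : h x = 0) (hf' : fderiv ℝ f x ≠ 0) (hh' : fderiv ℝ h x ≠ 0)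
    (himp : ∀ᶠ z in 𝓝 x, 0 < f z → 0 ≤ h z) :
    ∃ r : ℝ, 0 < r ∧ fderiv ℝ h x = r • fderiv ℝ f x ∧ ∀ v, fderiv ℝ f x v = 0 →
      r * fderiv ℝ (fderiv ℝ f) x v v ≤ fderiv ℝ (fderiv ℝ h) x v v := by
  have htend : ∀ v w : E, Tendsto (fun τ : ℝ => x + τ • v + τ ^ 2 • w) (𝓝[>] 0) (𝓝 x) := by
    intro v w
    have := (hasDerivAt_parabola x v w 0).continuousAt.tendsto
    simp only [zero_smul, add_zero, ne_eq, OfNat.ofNat_ne_zero, not_false_eq_true, zero_pow] at this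
    exact this.mono_left nhdsWithin_le_nhds
  have hfst : ∀ v, 0 < fderiv ℝ f x v → 0 ≤ fderiv ℝ h x v := by
    intro v hv
    by_contra! hlt
    have h1 := eventually_pos_of_hasDerivAt_pos
      (hf.eventually_hasDerivAt_parabola v 0).self_of_nhds (by simp [hf0]) (by simpa using hv)
    have h2 := eventually_pos_of_hasDerivAt_pos
      (hh.eventually_hasDerivAt_parabola v 0).self_of_nhds.neg (by simp [hh0]) (by simpa using hlt)
    obtain ⟨τ, ⟨ha, hb⟩, hc⟩ := ((h1.and h2).and ((htend v 0).eventually himp)).exists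
    have := hc ha
    simp only [Pi.neg_apply] at hb
    linarith
  obtain ⟨w, hw⟩ : ∃ w, fderiv ℝ f x w = 1 := by
    obtain ⟨u, hu⟩ := DFunLike.exists_ne hf'
    refine ⟨(fderiv ℝ f x u)⁻¹ • u, ?_⟩
    simp only [map_smul, smul_eq_mul]
    exact inv_mul_cancel₀ hu
  have hker : ∀ v, fderiv ℝ f x v = 0 → fderiv ℝ h x v = 0 := by
    have hnn : ∀ v, fderiv ℝ f x v = 0 → 0 ≤ fderiv ℝ h x v := by
      intro v hv
      by_contra! hlt
      -- Adding a large multiple of `v` to `w` keeps the derivative of `f` equal to `1` but makes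
      -- that of `h` negative.
      obtain ⟨k, hk⟩ := exists_nat_gt (fderiv ℝ h x w / -(fderiv ℝ h x v))
      have h1 := hfst (w + (k : ℝ) • v) (by simp [hw, hv])
      rw [div_lt_iff₀ (by linarith)] at hk
      simp only [map_add, map_smul, smul_eq_mul] at h1
      nlinarith
    intro v hv
    have h1 := hnn v hv
    have h2 := hnn (-v) (by simp [hv])
    rw [map_neg] at h2
    linarith
  have hprop : fderiv ℝ h x = fderiv ℝ h x w • fderiv ℝ f x := by
    ext v
    have := hker (v - fderiv ℝ f x v • w) (by simp [hw])
    simp only [map_sub, map_smul, smul_eq_mul] at this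
    simp only [FunLike.coe_smul, Pi.smul_apply, smul_eq_mul]
    linarith
  have hpos : 0 < fderiv ℝ h x w := by
    refine lt_of_le_of_ne (hfst w (by simp [hw])) fun h0 => hh' ?_
    rw [hprop, ← h0, zero_smul]
  refine ⟨_, hpos, hprop, fun v hv => ?_⟩
  refine le_of_forall_pos_le_add fun η hη => ?_
  set q := fderiv ℝ (fderiv ℝ f) x v v with hq
  set r := fderiv ℝ h x w with hr
  -- Along the parabola bent by `s • w` the second derivative of `f` is `η / (2 * r) > 0`, while
  -- that of `h` is below `-η / 2`: the curve enters `f > 0` where `h < 0`.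
  set s : ℝ := -q / 2 + η / (4 * r) with hs
  by_contra! hlt
  have h1 := eventually_pos_of_second_deriv_pos (hf.eventually_hasDerivAt_parabola v (s • w))
    (hf.hasDerivAt_fderiv_parabola v (s • w)) (by simp [hf0]) (by simp [hv]) (by
      simp only [map_smul, hw, smul_eq_mul, mul_one, ← hq, hs]
      have : 0 < η / (4 * r) := by positivity
      linarith)
  have h2 := eventually_pos_of_second_deriv_pos
    ((hh.eventually_hasDerivAt_parabola v (s • w)).mono fun τ hτ => hτ.neg)
    (hh.hasDerivAt_fderiv_parabola v (s • w)).neg (by simp [hh0]) (by simp [hker v hv]) (by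
      have hsr : s * r = -(r * q) / 2 + η / 4 := by
        rw [hs]
        field_simp
      simp only [map_smul, ← hr, smul_eq_mul, hsr]
      linarith)
  obtain ⟨τ, ⟨ha, hb⟩, hc⟩ := ((h1.and h2).and ((htend v (s • w)).eventually himp)).exists
  have := hc ha
  simp only [Pi.neg_apply] at hb
  linarith

end SecondOrder

/-! ### A smooth convex substitute for `|t| / 2`. -/

noncomputable section

/-- A smooth nondecreasing function equal to `-1/2` on `(-∞, -1]` and to `1/2` on `[1, ∞)`. -/
def smoothHalfSign (t : ℝ) : ℝ := Real.smoothTransition ((t + 1) / 2) - 1 / 2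

/-- A smooth convex function which agrees with `|t| / 2` outside `(-1, 1)`. -/
def smoothHalfAbs (t : ℝ) : ℝ := 1 / 2 + ∫ u in (-1)..t, smoothHalfSign u

end

theorem contDiff_smoothHalfSign : ContDiff ℝ ∞ smoothHalfSign := by
  unfold smoothHalfSign
  exact (Real.smoothTransition.contDiff.comp (by fun_prop)).sub contDiff_const

theorem continuous_smoothHalfSign : Continuous smoothHalfSign := contDiff_smoothHalfSign.continuous

theorem monotone_smoothHalfSign : Monotone smoothHalfSign := fun s t hst => by
  unfold smoothHalfSign
  have := Real.smoothTransition.monotone (show (s + 1) / 2 ≤ (t + 1) / 2 by linarith)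
  linarith

theorem smoothHalfSign_of_one_le {t : ℝ} (ht : 1 ≤ t) : smoothHalfSign t = 1 / 2 := by
  rw [smoothHalfSign, Real.smoothTransition.one_of_one_le (by linarith)]
  norm_num

theorem smoothHalfSign_of_le_neg_one {t : ℝ} (ht : t ≤ -1) : smoothHalfSign t = -1 / 2 := by
  rw [smoothHalfSign, Real.smoothTransition.zero_of_nonpos (by linarith)]
  norm_num

theorem smoothHalfSign_le (t : ℝ) : smoothHalfSign t ≤ 1 / 2 := by
  have := Real.smoothTransition.le_one ((t + 1) / 2)
  unfold smoothHalfSign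
  linarith

theorem le_smoothHalfSign (t : ℝ) : -1 / 2 ≤ smoothHalfSign t := by
  have := Real.smoothTransition.nonneg ((t + 1) / 2)
  unfold smoothHalfSign
  linarith

theorem smoothHalfSign_lt {t : ℝ} (ht : t < 1) : smoothHalfSign t < 1 / 2 := by
  have := Real.smoothTransition.lt_one_of_lt_one (show (t + 1) / 2 < 1 by linarith)
  unfold smoothHalfSign
  linarith

theorem smoothHalfSign_neg (t : ℝ) : smoothHalfSign (-t) = -smoothHalfSign t := by
  have h1 := Real.smoothTransition.pos_denom ((t + 1) / 2)
  unfold smoothHalfSign Real.smoothTransition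
  have e1 : (-t + 1) / 2 = 1 - (t + 1) / 2 := by ring
  rw [e1, sub_sub_cancel, add_comm (expNegInvGlue (1 - (t + 1) / 2))]
  generalize expNegInvGlue ((t + 1) / 2) = a at *
  generalize expNegInvGlue (1 - (t + 1) / 2) = b at *
  field_simp
  ring

theorem hasDerivAt_smoothHalfAbs (t : ℝ) : HasDerivAt smoothHalfAbs (smoothHalfSign t) t :=
  (intervalIntegral.integral_hasDerivAt_right (continuous_smoothHalfSign.intervalIntegrable _ _)
    (continuous_smoothHalfSign.stronglyMeasurableAtFilter _ _)
    continuous_smoothHalfSign.continuousAt).const_add _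

theorem contDiff_smoothHalfAbs : ContDiff ℝ ∞ smoothHalfAbs := by
  rw [contDiff_infty_iff_deriv]
  refine ⟨fun t => (hasDerivAt_smoothHalfAbs t).differentiableAt, ?_⟩
  rw [show deriv smoothHalfAbs = smoothHalfSign from
    funext fun t => (hasDerivAt_smoothHalfAbs t).deriv]
  exact contDiff_smoothHalfSign

theorem smoothHalfAbs_sub (s t : ℝ) :
    smoothHalfAbs t - smoothHalfAbs s = ∫ u in s..t, smoothHalfSign u := by
  unfold smoothHalfAbs
  have := intervalIntegral.integral_add_adjacent_intervals
    (continuous_smoothHalfSign.intervalIntegrable (-1) s (μ := MeasureTheory.volume))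
    (continuous_smoothHalfSign.intervalIntegrable s t)
  linarith

/-- Convexity as a supporting line inequality, from the monotone derivative. Concavity and touching
properties of `smoothMin` rest on it. -/
theorem smoothHalfAbs_tangent_le (s t : ℝ) :
    smoothHalfAbs s + smoothHalfSign s * (t - s) ≤ smoothHalfAbs t := by
  have h := smoothHalfAbs_sub s t
  rcases le_total s t with hst | hst
  · have := intervalIntegral.integral_mono_on (μ := MeasureTheory.volume) hst
      (intervalIntegrable_const (c := smoothHalfSign s))
      (continuous_smoothHalfSign.intervalIntegrable s t)
      fun u hu => monotone_smoothHalfSign hu.1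
    rw [intervalIntegral.integral_const, smul_eq_mul] at this
    linarith
  · have := intervalIntegral.integral_mono_on (μ := MeasureTheory.volume) hst
      (continuous_smoothHalfSign.intervalIntegrable t s)
      (intervalIntegrable_const (c := smoothHalfSign s))
      fun u hu => monotone_smoothHalfSign hu.2
    rw [intervalIntegral.integral_const, smul_eq_mul, intervalIntegral.integral_symm] at this
    linarith

theorem smoothHalfAbs_neg (t : ℝ) : smoothHalfAbs (-t) = smoothHalfAbs t := by
  have h1 := smoothHalfAbs_sub (-t) t
  have h2 : ∫ u in (-t)..t, smoothHalfSign (-u) = ∫ u in (-t)..t, smoothHalfSign u := by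
    rw [intervalIntegral.integral_comp_neg]
    simp
  simp only [smoothHalfSign_neg, intervalIntegral.integral_neg] at h2
  linarith

theorem smoothHalfAbs_of_le_neg_one {t : ℝ} (ht : t ≤ -1) : smoothHalfAbs t = -t / 2 := by
  have h : ∫ u in (-1)..t, smoothHalfSign u = ∫ u in (-1)..t, (-1 / 2 : ℝ) := by
    refine intervalIntegral.integral_congr fun u hu => ?_
    rw [uIcc_of_ge ht] at hu
    exact smoothHalfSign_of_le_neg_one hu.2
  rw [smoothHalfAbs, h, intervalIntegral.integral_const, smul_eq_mul]
  ring

theorem smoothHalfAbs_of_one_le {t : ℝ} (ht : 1 ≤ t) : smoothHalfAbs t = t / 2 := by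
  rw [← smoothHalfAbs_neg, smoothHalfAbs_of_le_neg_one (by linarith)]
  ring

theorem abs_div_two_le_smoothHalfAbs (t : ℝ) : |t| / 2 ≤ smoothHalfAbs t := by
  have h1 := smoothHalfAbs_tangent_le 1 t
  have h2 := smoothHalfAbs_tangent_le (-1) t
  rw [smoothHalfAbs_of_one_le le_rfl, smoothHalfSign_of_one_le le_rfl] at h1
  rw [smoothHalfAbs_of_le_neg_one le_rfl, smoothHalfSign_of_le_neg_one le_rfl] at h2
  rcases abs_cases t with ⟨h, _⟩ | ⟨h, _⟩ <;> rw [h] <;> linarith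

theorem smoothHalfAbs_le {t : ℝ} (ht : |t| ≤ 1) : smoothHalfAbs t ≤ 1 / 2 := by
  have h0 := smoothHalfAbs_tangent_le t 1
  have h1 := smoothHalfAbs_tangent_le t (-1)
  rw [smoothHalfAbs_of_one_le le_rfl] at h0
  rw [smoothHalfAbs_of_le_neg_one le_rfl] at h1
  obtain ⟨ha, hb⟩ := abs_le.1 ht
  nlinarith

/-- The intercept of the tangent line at a point of `(-1, 1)` is positive. -/
theorem smoothHalfAbs_intercept_pos {t : ℝ} (ht : |t| < 1) :
    0 < smoothHalfAbs t - t * smoothHalfSign t := by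
  have key : ∀ s : ℝ, 0 ≤ s → s < 1 → 0 < smoothHalfAbs s - s * smoothHalfSign s := by
    intro s h0 h1
    have := abs_div_two_le_smoothHalfAbs s
    have h2 := smoothHalfSign_lt h1
    rcases h0.eq_or_lt with rfl | hpos
    · have h3 := smoothHalfAbs_tangent_le 1 ((1:ℝ)/2)
      have h5 := smoothHalfAbs_tangent_le (1/2) (0 : ℝ)
      have h4 := smoothHalfSign_lt (show (1 / 2 : ℝ) < 1 by norm_num)
      rw [smoothHalfAbs_of_one_le le_rfl, smoothHalfSign_of_one_le le_rfl] at h3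
      linarith
    · rw [abs_of_pos hpos] at this
      nlinarith
  obtain ⟨ha, hb⟩ := abs_lt.1 ht
  rcases le_total 0 t with h | h
  · exact key t h hb
  · have := key (-t) (by linarith) (by linarith)
    rw [smoothHalfAbs_neg, smoothHalfSign_neg] at this
    linarith

/-! ### Gradients and Hessians. -/

section Gradient

variable {E : Type*} [NormedAddCommGroup E] [InnerProductSpace ℝ E] [CompleteSpace E]
  {f : E → ℝ} {x : E} {U : Set E}

/-- The Riesz identification of the dual of a real Hilbert space, as a linear map. -/
noncomputable def rieszCLM (E : Type*) [NormedAddCommGroup E] [InnerProductSpace ℝ E]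
    [CompleteSpace E] : StrongDual ℝ E →L[ℝ] E where
  toFun := (InnerProductSpace.toDual ℝ E).symm
  map_add' := map_add _
  map_smul' c y := by simp
  cont := (InnerProductSpace.toDual ℝ E).symm.continuous

theorem ContDiffOn.gradient (hf : ContDiffOn ℝ ∞ f U) (hU : IsOpen U) :
    ContDiffOn ℝ ∞ (gradient f) U :=
  (rieszCLM E).contDiff.comp_contDiffOn (hf.fderiv_of_isOpen hU le_rfl)

theorem ContDiffAt.differentiableAt_gradient (hf : ContDiffAt ℝ 2 f x) :
    DifferentiableAt ℝ (_root_.gradient f) x :=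
  (rieszCLM E).differentiableAt.comp x hf.differentiableAt_fderiv

theorem ContDiffAt.inner_fderiv_gradient (hf : ContDiffAt ℝ 2 f x) (v w : E) :
    Inner.inner ℝ (fderiv ℝ (_root_.gradient f) x v) w = fderiv ℝ (fderiv ℝ f) x v w := by
  have h : HasFDerivAt (_root_.gradient f) ((rieszCLM E).comp (fderiv ℝ (fderiv ℝ f) x)) x :=
    (rieszCLM E).hasFDerivAt.comp x hf.differentiableAt_fderiv.hasFDerivAt
  rw [h.fderiv]
  exact InnerProductSpace.toDual_symm_apply

theorem norm_gradient : ‖gradient f x‖ = ‖fderiv ℝ f x‖ :=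
  LinearIsometryEquiv.norm_map _ _

theorem gradient_ne_zero_iff : gradient f x ≠ 0 ↔ fderiv ℝ f x ≠ 0 := by
  rw [← norm_ne_zero_iff, norm_gradient, norm_ne_zero_iff]

end Gradient

/-! ### The signed distance to a boundary. -/

/-- The signed distance to the boundary of `A`, positive inside of `A`. -/
noncomputable def signedInfDist {E : Type*} [PseudoMetricSpace E] (A : Set E) (x : E) : ℝ :=
  infDist x Aᶜ - infDist x A

section SignedDist

variable {E : Type*} [PseudoMetricSpace E] {A : Set E} {x y : E}

theorem continuous_signedInfDist (A : Set E) : Continuous (signedInfDist A) :=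
  (continuous_infDist_pt _).sub (continuous_infDist_pt _)

theorem signedInfDist_of_mem (hx : x ∈ A) : signedInfDist A x = infDist x Aᶜ := by
  rw [signedInfDist, infDist_zero_of_mem hx, sub_zero]

theorem signedInfDist_of_notMem (hx : x ∉ A) : signedInfDist A x = -infDist x A := by
  rw [signedInfDist, infDist_zero_of_mem (mem_compl hx), zero_sub]

theorem signedInfDist_nonneg_of_mem_closure (hx : x ∈ closure A) : 0 ≤ signedInfDist A x := by
  rw [signedInfDist, infDist_zero_of_mem_closure hx, sub_zero]
  exact infDist_nonneg

theorem signedInfDist_pos_iff (hA : IsOpen A) (hne : A ≠ univ) : 0 < signedInfDist A x ↔ x ∈ A := by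
  constructor
  · intro h
    by_contra hx
    rw [signedInfDist_of_notMem hx] at h
    have := infDist_nonneg (x := x) (s := A)
    linarith
  · intro h
    rw [signedInfDist_of_mem h]
    exact (hA.isClosed_compl.notMem_iff_infDist_pos (nonempty_compl.2 hne)).1 (by simpa)

theorem mem_frontier_of_signedInfDist_eq_zero (hA : IsOpen A) (hne : A ≠ univ)
    (hx : x ∈ closure A) (h : signedInfDist A x = 0) : x ∈ frontier A := by
  rw [hA.frontier_eq]
  exact ⟨hx, fun hxA => ((signedInfDist_pos_iff hA hne).2 hxA).ne' h⟩

theorem signedInfDist_of_mem_frontier (hA : IsOpen A) (hx : x ∈ frontier A) :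
    signedInfDist A x = 0 := by
  rw [hA.frontier_eq] at hx
  rw [signedInfDist_of_notMem hx.2, infDist_zero_of_mem_closure hx.1, neg_zero]

end SignedDist

section SignedDistNormed

variable {E : Type*} [NormedAddCommGroup E] [NormedSpace ℝ E] {A : Set E} {x : E}

/-- Only the passage from `x` inside to `y` outside needs an argument: the segment meets the
frontier, and the distances of its ends to that point add up to `dist x y`. -/
theorem signedInfDist_le_add_dist (hA : IsOpen A) (x y : E) :
    signedInfDist A x ≤ dist x y + signedInfDist A y := by
  by_cases hx : x ∈ A
  · by_cases hy : y ∈ A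
    · rw [signedInfDist_of_mem hx, signedInfDist_of_mem hy]
      exact infDist_le_infDist_add_dist.trans_eq (add_comm _ _)
    · rw [signedInfDist_of_mem hx, signedInfDist_of_notMem hy]
      obtain ⟨z, hz, hzA⟩ : ∃ z ∈ segment ℝ x y, z ∈ frontier A := by
        by_contra! hno
        obtain ⟨z, hz, hzA, hzA'⟩ := (convex_segment x y).isPreconnected A (closure A)ᶜ hA
          isClosed_closure.isOpen_compl
          (fun z hz => by
            by_contra hz'
            rw [mem_union, not_or, notMem_compl_iff] at hz'
            exact hno z hz (by rw [hA.frontier_eq]; exact ⟨hz'.2, hz'.1⟩))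
          ⟨x, left_mem_segment ℝ x y, hx⟩
          ⟨y, right_mem_segment ℝ x y, fun hy' =>
            hno y (right_mem_segment ℝ x y) (by rw [hA.frontier_eq]; exact ⟨hy', hy⟩)⟩
        exact hzA' (subset_closure hzA)
      rw [hA.frontier_eq] at hzA
      have h1 : infDist x Aᶜ ≤ dist x z := infDist_le_dist_of_mem hzA.2
      have h2 : infDist y A ≤ dist y z := by
        rw [← infDist_closure]
        exact infDist_le_dist_of_mem hzA.1
      have h3 := dist_add_dist_of_mem_segment hz
      rw [dist_comm y z] at h2
      linarith
  · rw [signedInfDist_of_notMem hx]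
    by_cases hy : y ∈ A
    · rw [signedInfDist_of_mem hy]
      have h1 := infDist_nonneg (x := x) (s := A)
      have h2 := infDist_nonneg (x := y) (s := Aᶜ)
      have h3 := dist_nonneg (x := x) (y := y)
      linarith
    · rw [signedInfDist_of_notMem hy]
      have := infDist_le_infDist_add_dist (x := y) (y := x) (s := A)
      rw [dist_comm] at this
      linarith

theorem exists_mem_frontier_dist_eq_signedInfDist [FiniteDimensional ℝ E] (hA : IsOpen A)
    (hne : A ≠ univ) (hx : x ∈ closure A) : ∃ y ∈ frontier A, dist x y = signedInfDist A x := by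
  by_cases hxA : x ∈ A
  · obtain ⟨y, hy, h⟩ := exists_mem_frontier_infDist_compl_eq_dist hxA hne
    exact ⟨y, hy, by rw [signedInfDist_of_mem hxA, h]⟩
  · have hf : x ∈ frontier A := by rw [hA.frontier_eq]; exact ⟨hx, hxA⟩
    exact ⟨x, hf, by rw [dist_self, signedInfDist_of_mem_frontier hA hf]⟩

end SignedDistNormed

/-! ### Smooth boundaries and normal coordinates. -/

section Smooth

variable {n : ℕ} {A : Set (EuclideanSpace ℝ (Fin n))} {x : EuclideanSpace ℝ (Fin n)}
  {φ : EuclideanSpace ℝ (Fin n) → ℝ} {U : Set (EuclideanSpace ℝ (Fin n))}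

theorem contDiffOn_unitNormalField (hU : IsOpen U) (hφ : ContDiffOn ℝ ∞ φ U)
    (hg : ∀ y ∈ U, gradient φ y ≠ 0) : ContDiffOn ℝ ∞ (unitNormalField φ) U := by
  have h := hφ.gradient hU
  exact ((h.norm ℝ hg).inv fun y hy => norm_ne_zero_iff.2 (hg y hy)).smul h

theorem norm_unitNormalField (hg : gradient φ x ≠ 0) : ‖unitNormalField φ x‖ = 1 := by
  rw [unitNormalField, norm_smul, norm_inv, norm_norm, inv_mul_cancel₀ (norm_ne_zero_iff.2 hg)]

theorem inner_unitNormalField_eq_zero (hg : fderiv ℝ φ x y = 0) :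
    inner ℝ (unitNormalField φ x) y = 0 := by
  rw [unitNormalField, inner_smul_left, inner_gradient_left, hg, mul_zero]

theorem eq_zero_of_mem_frontier (hA : IsOpen A) (hU : IsOpen U) (hφ : ContinuousOn φ U)
    (h : ∀ y ∈ U, y ∈ A ↔ 0 < φ y) (hx : x ∈ U) (hxA : x ∈ frontier A) : φ x = 0 := by
  rw [hA.frontier_eq] at hxA
  have h1 : φ x ≤ 0 := not_lt.1 fun h' => hxA.2 ((h x hx).2 h')
  refine le_antisymm h1 (not_lt.1 fun hneg => ?_)
  have hev : ∀ᶠ z in 𝓝 x, φ z < 0 ∧ z ∈ U :=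
    ((hφ.continuousAt (hU.mem_nhds hx)).eventually_lt_const hneg).and (hU.mem_nhds hx)
  obtain ⟨z, hzA, hz, hzU⟩ := ((mem_closure_iff_frequently.1 hxA.1).and_eventually hev).exists
  exact absurd ((h z hzU).1 hzA) (by linarith)

/-- A noncritical zero is not a local maximum, so points of `A` accumulate there. -/
theorem mem_frontier_of_eq_zero (hU : IsOpen U) (hg : gradient φ x ≠ 0)
    (h : ∀ y ∈ U, y ∈ A ↔ 0 < φ y) (hx : x ∈ U) (h0 : φ x = 0) : x ∈ frontier A := by
  have hxA : x ∉ A := fun h' => by simpa [h0] using (h x hx).1 h'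
  refine ⟨?_, fun h' => hxA (interior_subset h')⟩
  by_contra hcl
  refine gradient_ne_zero_iff.1 hg (IsLocalMax.fderiv_eq_zero ?_)
  filter_upwards [isClosed_closure.isOpen_compl.mem_nhds hcl, hU.mem_nhds hx] with z hz hzU
  rw [h0]
  exact not_lt.1 fun h' => hz (subset_closure ((h z hzU).2 h'))

end Smooth

section InverseFunction

variable {n : ℕ} {A : Set (EuclideanSpace ℝ (Fin n))} {x₀ : EuclideanSpace ℝ (Fin n)}
  {φ : EuclideanSpace ℝ (Fin n) → ℝ} {U : Set (EuclideanSpace ℝ (Fin n))}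

/-- Normal coordinates along the level sets of `φ`. -/
noncomputable def normalMap (φ : EuclideanSpace ℝ (Fin n) → ℝ) (q : EuclideanSpace ℝ (Fin n) × ℝ) :
    EuclideanSpace ℝ (Fin n) × ℝ :=
  (q.1 + q.2 • unitNormalField φ q.1, φ q.1)

theorem contDiffAt_normalMap (hU : IsOpen U) (hφ : ContDiffOn ℝ ∞ φ U)
    (hg : ∀ y ∈ U, gradient φ y ≠ 0) {q : EuclideanSpace ℝ (Fin n) × ℝ} (hq : q.1 ∈ U) :
    ContDiffAt ℝ ∞ (normalMap φ) q := by
  have h1 : ContDiffAt ℝ ∞ (unitNormalField φ) q.1 :=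
    (contDiffOn_unitNormalField hU hφ hg).contDiffAt (hU.mem_nhds hq)
  have h2 : ContDiffAt ℝ ∞ φ q.1 := hφ.contDiffAt (hU.mem_nhds hq)
  unfold normalMap
  exact (contDiffAt_fst.add (contDiffAt_snd.smul (h1.comp q contDiffAt_fst))).prodMk
    (h2.comp q contDiffAt_fst)

/-- The component `φ` makes domain and target of equal dimension, so no chart of the boundary is
needed. The derivative `(v, s) ↦ (v + s ν, Dφ v)` is injective: `Dφ v = 0` means `v ⊥ ν`, and
pairing with `ν` then gives `s = 0`. -/
theorem exists_equiv_hasFDerivAt_normalMap (hU : IsOpen U) (hφ : ContDiffOn ℝ ∞ φ U)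
    (hg : ∀ y ∈ U, gradient φ y ≠ 0) (hx₀ : x₀ ∈ U) :
    ∃ e : (EuclideanSpace ℝ (Fin n) × ℝ) ≃L[ℝ] (EuclideanSpace ℝ (Fin n) × ℝ),
      HasFDerivAt (normalMap φ) (e : EuclideanSpace ℝ (Fin n) × ℝ →L[ℝ] _) (x₀, 0) := by
  have h1 : HasFDerivAt (unitNormalField φ) (fderiv ℝ (unitNormalField φ) x₀) x₀ :=
    ((contDiffOn_unitNormalField hU hφ hg).contDiffAt
      (hU.mem_nhds hx₀)).differentiableAt (by simp) |>.hasFDerivAt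
  have h2 : HasFDerivAt φ (fderiv ℝ φ x₀) x₀ :=
    (hφ.contDiffAt (hU.mem_nhds hx₀)).differentiableAt (by simp) |>.hasFDerivAt
  have hfst : HasFDerivAt (Prod.fst : EuclideanSpace ℝ (Fin n) × ℝ → _)
    (ContinuousLinearMap.fst ℝ _ ℝ) (x₀, 0) := hasFDerivAt_fst
  have hsnd : HasFDerivAt (Prod.snd : EuclideanSpace ℝ (Fin n) × ℝ → _)
    (ContinuousLinearMap.snd ℝ _ ℝ) (x₀, 0) := hasFDerivAt_snd
  let D : EuclideanSpace ℝ (Fin n) × ℝ →L[ℝ] EuclideanSpace ℝ (Fin n) × ℝ :=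
    (ContinuousLinearMap.fst ℝ _ ℝ +
      (ContinuousLinearMap.snd ℝ _ ℝ).smulRight (unitNormalField φ x₀)).prod
      ((fderiv ℝ φ x₀).comp (ContinuousLinearMap.fst ℝ _ ℝ))
  have h3 : HasFDerivAt (normalMap φ) D (x₀, 0) := by
    refine ((hfst.fun_add (hsnd.fun_smul (HasFDerivAt.comp (x₀, (0 : ℝ)) h1 hfst))).prodMk
      (HasFDerivAt.comp (x₀, (0 : ℝ)) h2 hfst)).congr_fderiv ?_
    refine ContinuousLinearMap.ext fun q => ?_
    simp [D]
  have hinj : Function.Injective D := by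
    rw [injective_iff_map_eq_zero]
    rintro ⟨v, s⟩ hvs
    have hvs' : v + s • unitNormalField φ x₀ = 0 ∧ fderiv ℝ φ x₀ v = 0 := by
      simpa [D, Prod.ext_iff] using hvs
    have h4 := inner_unitNormalField_eq_zero hvs'.2
    have h5 := congrArg (inner ℝ (unitNormalField φ x₀)) hvs'.1
    rw [inner_add_right, h4, inner_smul_right, real_inner_self_eq_norm_sq,
      norm_unitNormalField (hg x₀ hx₀), inner_zero_right] at h5
    have hs : s = 0 := by linarith
    rw [hs, zero_smul, add_zero] at hvs'
    exact Prod.ext hvs'.1 hs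
  refine ⟨(LinearEquiv.ofInjectiveEndo (D : _ →ₗ[ℝ] _) hinj).toContinuousLinearEquiv, ?_⟩
  exact h3

/-- A smooth function `t` near a boundary point, solving `x = y + t ν(y)` with `y` in
the boundary. -/
theorem exists_normal_coordinates (hU : IsOpen U) (hφ : ContDiffOn ℝ ∞ φ U)
    (hg : ∀ y ∈ U, gradient φ y ≠ 0) (hx₀ : x₀ ∈ U) (h0 : φ x₀ = 0) :
    ∃ (y : EuclideanSpace ℝ (Fin n) → EuclideanSpace ℝ (Fin n))
      (t : EuclideanSpace ℝ (Fin n) → ℝ) (V : Set (EuclideanSpace ℝ (Fin n))),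
      IsOpen V ∧ x₀ ∈ V ∧ ContDiffOn ℝ ∞ y V ∧ ContDiffOn ℝ ∞ t V ∧ y x₀ = x₀ ∧
      (∀ x ∈ V, y x ∈ U ∧ φ (y x) = 0 ∧ x = y x + t x • unitNormalField φ (y x)) ∧
      ∀ x ∈ V, φ x = 0 → t x = 0 := by
  obtain ⟨e, he⟩ := exists_equiv_hasFDerivAt_normalMap hU hφ hg hx₀
  have hC := contDiffAt_normalMap hU hφ hg (q := (x₀, 0)) hx₀
  set Φ := hC.toOpenPartialHomeomorph (normalMap φ) he (by simp) with hΦ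
  have hcoe : ∀ q, Φ q = normalMap φ q := fun q => rfl
  have hsrc : (x₀, (0 : ℝ)) ∈ Φ.source := hC.mem_toOpenPartialHomeomorph_source he (by simp)
  have hbase : Φ (x₀, 0) = (x₀, 0) := by simp [hcoe, normalMap, h0]
  have htgt : (x₀, (0 : ℝ)) ∈ Φ.target := hbase ▸ Φ.map_source hsrc
  have hsymm : Φ.symm (x₀, 0) = (x₀, 0) := by
    conv_lhs => rw [← hbase]
    exact Φ.left_inv hsrc
  -- The inverse is smooth wherever the derivative is invertible; this is an open condition, so it
  -- survives on a neighbourhood.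
  have hinv : ∀ᶠ q in 𝓝 (x₀, (0 : ℝ)), fderiv ℝ (normalMap φ) q ∈
      range ((↑) : ((EuclideanSpace ℝ (Fin n) × ℝ) ≃L[ℝ] (EuclideanSpace ℝ (Fin n) × ℝ)) → _) := by
    have hc : ContinuousAt (fderiv ℝ (normalMap φ)) (x₀, 0) :=
      (hC.fderiv_right (m := 0) (by simp)).continuousAt
    refine hc.eventually_mem ?_
    rw [he.fderiv]
    exact e.nhds
  have hq : ∀ᶠ q in 𝓝 (x₀, (0 : ℝ)), q.1 ∈ U ∧ fderiv ℝ (normalMap φ) q ∈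
      range ((↑) : ((EuclideanSpace ℝ (Fin n) × ℝ) ≃L[ℝ] (EuclideanSpace ℝ (Fin n) × ℝ)) → _) :=
    (continuousAt_fst.eventually_mem (hU.mem_nhds hx₀)).and hinv
  have hi : ContinuousAt (fun x : EuclideanSpace ℝ (Fin n) => (x, (0 : ℝ))) x₀ := by fun_prop
  have hs : ContinuousAt Φ.symm (x₀, 0) := Φ.continuousAt_symm htgt
  have hall : ∀ᶠ x in 𝓝 x₀, (x, (0 : ℝ)) ∈ Φ.target ∧ (x, (0 : ℝ)) ∈ Φ.source ∧ x ∈ U ∧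
      (Φ.symm (x, 0)).1 ∈ U ∧ fderiv ℝ (normalMap φ) (Φ.symm (x, 0)) ∈
      range ((↑) : ((EuclideanSpace ℝ (Fin n) × ℝ) ≃L[ℝ] (EuclideanSpace ℝ (Fin n) × ℝ)) → _) := by
    have h1 := hi.eventually_mem (Φ.open_target.mem_nhds htgt)
    have h2 := hi.eventually_mem (Φ.open_source.mem_nhds hsrc)
    have h3' : Tendsto (fun x : EuclideanSpace ℝ (Fin n) => Φ.symm (x, 0)) (𝓝 x₀)
        (𝓝 (x₀, 0)) := by
      have := hs.tendsto.comp hi.tendsto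
      rwa [hsymm] at this
    have h3 := h3'.eventually hq
    filter_upwards [h1, h2, hU.mem_nhds hx₀, h3] with x a b c d
    exact ⟨a, b, c, d.1, d.2⟩
  obtain ⟨V, hV, hVo, hxV⟩ := _root_.eventually_nhds_iff.1 hall
  have hsm : ContDiffOn ℝ ∞ (fun x => Φ.symm (x, 0)) V := by
    intro x hx
    obtain ⟨h1, -, -, h4, e', he'⟩ := hV x hx
    have hCx := contDiffAt_normalMap hU hφ hg h4
    have hD : HasFDerivAt Φ (e' : EuclideanSpace ℝ (Fin n) × ℝ →L[ℝ] _) (Φ.symm (x, 0)) := by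
      rw [he']
      exact (hCx.differentiableAt (by simp)).hasFDerivAt
    have := Φ.contDiffAt_symm h1 hD hCx
    exact (this.comp x (by fun_prop)).contDiffWithinAt
  refine ⟨fun x => (Φ.symm (x, 0)).1, fun x => (Φ.symm (x, 0)).2, V, hVo, hxV,
    contDiff_fst.comp_contDiffOn hsm, contDiff_snd.comp_contDiffOn hsm, by simp [hsymm],
    fun x hx => ?_, fun x hx hx0 => ?_⟩
  · obtain ⟨h1, -, -, h4, -⟩ := hV x hx
    have h := Φ.right_inv h1
    rw [hcoe, normalMap, Prod.mk.injEq] at h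
    exact ⟨h4, h.2, h.1.symm⟩
  · obtain ⟨-, h2, -⟩ := hV x hx
    have h : Φ (x, 0) = (x, 0) := by simp [hcoe, normalMap, hx0]
    have h' : Φ.symm (x, 0) = (x, 0) := by
      conv_lhs => rw [← h]
      exact Φ.left_inv h2
    simp [h']

/-- Differentiate `x = y + t ν(y)` and pair with `ν(y)`. The derivative of `y` is orthogonal to `ν`
since `φ ∘ y = 0`, and that of `ν` since `ν` has length one; only `dt` remains. -/
theorem hasGradientAt_normal_coordinate (hU : IsOpen U) (hφ : ContDiffOn ℝ ∞ φ U)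
    (hg : ∀ y ∈ U, gradient φ y ≠ 0)
    {y : EuclideanSpace ℝ (Fin n) → EuclideanSpace ℝ (Fin n)}
    {t : EuclideanSpace ℝ (Fin n) → ℝ} {V : Set (EuclideanSpace ℝ (Fin n))} (hV : IsOpen V)
    (hy : ContDiffOn ℝ ∞ y V) (ht : ContDiffOn ℝ ∞ t V)
    (h : ∀ x ∈ V, y x ∈ U ∧ φ (y x) = 0 ∧ x = y x + t x • unitNormalField φ (y x))
    {x : EuclideanSpace ℝ (Fin n)} (hx : x ∈ V) :
    HasGradientAt t (unitNormalField φ (y x)) x := by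
  set ν := unitNormalField φ with hν
  have hyU := (h x hx).1
  have dy : HasFDerivAt y (fderiv ℝ y x) x :=
    ((hy.contDiffAt (hV.mem_nhds hx)).differentiableAt (by simp)).hasFDerivAt
  have dt : HasFDerivAt t (fderiv ℝ t x) x :=
    ((ht.contDiffAt (hV.mem_nhds hx)).differentiableAt (by simp)).hasFDerivAt
  have dν : HasFDerivAt ν (fderiv ℝ ν (y x)) (y x) :=
    (((contDiffOn_unitNormalField hU hφ hg).contDiffAt (hU.mem_nhds hyU)).differentiableAt
      (by simp)).hasFDerivAt
  have dφ : HasFDerivAt φ (fderiv ℝ φ (y x)) (y x) :=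
    ((hφ.contDiffAt (hU.mem_nhds hyU)).differentiableAt (by simp)).hasFDerivAt
  have hperp : ∀ v, inner ℝ (ν (y x)) (fderiv ℝ y x v) = 0 := by
    intro v
    refine inner_unitNormalField_eq_zero ?_
    have h1 : HasFDerivAt (φ ∘ y) ((fderiv ℝ φ (y x)).comp (fderiv ℝ y x)) x := dφ.comp x dy
    have h2 : HasFDerivAt (φ ∘ y) (0 : _ →L[ℝ] ℝ) x :=
      (hasFDerivAt_const (0 : ℝ) x).congr_of_eventuallyEq
        (by filter_upwards [hV.mem_nhds hx] with z hz using (h z hz).2.1)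
    exact DFunLike.congr_fun (h1.unique h2) v
  have hunit : ∀ v, inner ℝ (ν (y x)) (fderiv ℝ ν (y x) v) = 0 := by
    intro v
    have h1 : HasFDerivAt (fun z => ‖ν z‖ ^ 2) _ (y x) := dν.norm_sq
    have h2 : HasFDerivAt (fun z => ‖ν z‖ ^ 2) (0 : _ →L[ℝ] ℝ) (y x) :=
      (hasFDerivAt_const (1 : ℝ) (y x)).congr_of_eventuallyEq
        (by
          filter_upwards [hU.mem_nhds hyU] with z hz
          rw [hν, norm_unitNormalField (hg z hz), one_pow])
    have := DFunLike.congr_fun (h1.unique h2) v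
    simpa using this
  have hid : HasFDerivAt (fun z => y z + t z • ν (y z)) (ContinuousLinearMap.id ℝ _) x :=
    (hasFDerivAt_id x).congr_of_eventuallyEq
      (by filter_upwards [hV.mem_nhds hx] with z hz using (h z hz).2.2.symm)
  have hsum := dy.fun_add (dt.fun_smul (dν.comp x dy))
  have heq := hsum.unique hid
  rw [hasGradientAt_iff_hasFDerivAt]
  refine dt.congr_fderiv (ContinuousLinearMap.ext fun v => ?_)
  have hv := congrArg (inner ℝ (ν (y x))) (DFunLike.congr_fun heq v)
  simp [inner_add_right, inner_smul_right, hperp, hunit] at hv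
  rw [InnerProductSpace.toDual_apply_apply, ← hv, hν, norm_unitNormalField (hg _ hyU)]
  simp

end InverseFunction

/-! ### Smoothness of the signed distance near the boundary. -/

section RegularSet

variable {n : ℕ} {A : Set (EuclideanSpace ℝ (Fin n))} {x : EuclideanSpace ℝ (Fin n)}

/-- The largest open set on which the signed distance is smooth with gradient of length one. -/
def distRegularSet (A : Set (EuclideanSpace ℝ (Fin n))) : Set (EuclideanSpace ℝ (Fin n)) :=
  ⋃₀ {V | IsOpen V ∧ ContDiffOn ℝ ∞ (signedInfDist A) V ∧
    ∀ z ∈ V, ‖gradient (signedInfDist A) z‖ = 1}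

theorem isOpen_distRegularSet : IsOpen (distRegularSet A) := isOpen_sUnion fun _ hV => hV.1

theorem contDiffOn_signedInfDist : ContDiffOn ℝ ∞ (signedInfDist A) (distRegularSet A) := by
  rintro x ⟨V, ⟨hV, hC, -⟩, hx⟩
  exact (hC.contDiffAt (hV.mem_nhds hx)).contDiffWithinAt

theorem contDiffAt_signedInfDist (hx : x ∈ distRegularSet A) :
    ContDiffAt ℝ ∞ (signedInfDist A) x :=
  contDiffOn_signedInfDist.contDiffAt (isOpen_distRegularSet.mem_nhds hx)

theorem norm_gradient_signedInfDist (hx : x ∈ distRegularSet A) :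
    ‖gradient (signedInfDist A) x‖ = 1 := by
  obtain ⟨V, ⟨-, -, h⟩, hx⟩ := hx
  exact h x hx

/-- Near a boundary point the signed distance is the normal coordinate `t`. The frontier point `y x`
at distance `|t x|` bounds the distance from above; the bound from below holds since `t` is
1-Lipschitz and vanishes on the frontier. -/
theorem frontier_subset_distRegularSet (hA : IsOpen A) (hA' : HasSmoothBoundary A)
    (hne : A ≠ univ) : frontier A ⊆ distRegularSet A := by
  intro x₀ hx₀
  obtain ⟨φ, U, hU, hxU, hφ, hg, hAφ⟩ := hA' x₀ hx₀
  have hfr : ∀ z ∈ U, z ∈ frontier A → φ z = 0 := fun z hz hzA =>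
    eq_zero_of_mem_frontier hA hU hφ.continuousOn hAφ hz hzA
  obtain ⟨y, t, V, hV, hxV, hy, ht, hyx₀, hyt, ht0⟩ :=
    exists_normal_coordinates hU hφ hg hxU (hfr x₀ hxU hx₀)
  set ν := unitNormalField φ with hν
  have hgc : ContinuousAt (gradient φ) x₀ :=
    (hφ.gradient hU).continuousOn.continuousAt (hU.mem_nhds hxU)
  have hνc : ContinuousAt ν x₀ :=
    (contDiffOn_unitNormalField hU hφ hg).continuousOn.continuousAt (hU.mem_nhds hxU)
  have hpos : 0 < inner ℝ (gradient φ x₀) (ν x₀) := by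
    rw [hν, unitNormalField, inner_smul_right, real_inner_self_eq_norm_sq]
    have := norm_pos_iff.2 (hg x₀ hxU)
    positivity
  have hev : ∀ᶠ q in 𝓝 (x₀, x₀), 0 < inner ℝ (gradient φ q.1) (ν q.2) := by
    have h1 := (ContinuousAt.fst' (y := x₀) hgc).inner (𝕜 := ℝ) (ContinuousAt.snd' (x := x₀) hνc)
    exact h1.eventually_const_lt hpos
  obtain ⟨ρ, hρ, hball⟩ : ∃ ρ > 0, ∀ z₁ ∈ ball x₀ ρ, ∀ z₂ ∈ ball x₀ ρ,
      z₁ ∈ U ∧ 0 < inner ℝ (gradient φ z₁) (ν z₂) := by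
    rw [nhds_prod_eq, eventually_prod_self_iff'] at hev
    obtain ⟨W, hW, hWW⟩ := hev
    obtain ⟨ρ, hρ, hsub⟩ := Metric.mem_nhds_iff.1 (inter_mem hW (hU.mem_nhds hxU))
    exact ⟨ρ, hρ, fun z₁ h₁ z₂ h₂ => ⟨(hsub h₁).2, hWW z₁ (hsub h₁).1 z₂ (hsub h₂).1⟩⟩
  have hyc : ContinuousAt y x₀ := hy.continuousOn.continuousAt (hV.mem_nhds hxV)
  obtain ⟨δ, hδ, hδsub⟩ := Metric.mem_nhds_iff.1 (inter_mem (hV.mem_nhds hxV) (inter_mem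
    (ball_mem_nhds x₀ hρ) (hyc.eventually_mem (by rw [hyx₀]; exact ball_mem_nhds x₀ hρ))))
  have hgrad : ∀ x ∈ V, HasGradientAt t (ν (y x)) x := fun x hx =>
    hasGradientAt_normal_coordinate hU hφ hg hV hy ht hyt hx
  have hνn : ∀ x ∈ V, ‖ν (y x)‖ = 1 := fun x hx => norm_unitNormalField (hg _ (hyt x hx).1)
  have hlip : ∀ x ∈ ball x₀ δ, ∀ z ∈ ball x₀ δ, |t x - t z| ≤ dist x z := by
    intro x hx z hz
    have := (convex_ball x₀ δ).norm_image_sub_le_of_norm_hasFDerivWithin_le (C := 1)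
      (fun w hw => (hgrad w (hδsub hw).1).hasFDerivAt.hasFDerivWithinAt)
      (fun w hw => by rw [LinearIsometryEquiv.norm_map, hνn w (hδsub hw).1]) hz hx
    rwa [one_mul, Real.norm_eq_abs, ← dist_eq_norm] at this
  -- The mean value theorem between `y x` and `x`, where `∇φ` has positive product with `ν`, shows
  -- that `φ` and `t` have the same sign.
  have hsign : ∀ x ∈ ball x₀ δ, ∃ r > 0, φ x = t x * r := by
    intro x hx
    obtain ⟨hxV, hxρ, hyρ⟩ := hδsub hx
    obtain ⟨z, hz, hmv⟩ := domain_mvt (f := φ) (s := ball x₀ ρ)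
      (fun w hw => ((hφ.contDiffAt (hU.mem_nhds (hball w hw w hw).1)).differentiableAt
        (by simp)).hasFDerivAt.hasFDerivWithinAt) (convex_ball x₀ ρ) hyρ hxρ
    have hzρ := (convex_ball x₀ ρ).segment_subset hyρ hxρ hz
    refine ⟨_, (hball z hzρ (y x) hyρ).2, ?_⟩
    have hxy : x - y x = t x • ν (y x) := by
      rw [sub_eq_iff_eq_add']
      exact (hyt x hxV).2.2
    rw [(hyt x hxV).2.1, sub_zero, hxy, map_smul, smul_eq_mul, ← inner_gradient_left] at hmv
    exact hmv
  have hdist : ∀ x ∈ ball x₀ δ, dist x (y x) = |t x| := by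
    intro x hx
    have hxy : x - y x = t x • ν (y x) := by
      rw [sub_eq_iff_eq_add']
      exact (hyt x (hδsub hx).1).2.2
    rw [dist_eq_norm, hxy, norm_smul, hνn x (hδsub hx).1, mul_one, Real.norm_eq_abs]
  have hyfr : ∀ x ∈ ball x₀ δ, y x ∈ frontier A := by
    intro x hx
    obtain ⟨h1, h2, -⟩ := hyt x (hδsub hx).1
    exact mem_frontier_of_eq_zero hU (hg _ h1) hAφ h1 h2
  have htz : ∀ z ∈ ball x₀ δ, z ∈ frontier A → t z = 0 := by
    intro z hz hzA
    obtain ⟨hzV, hzρ, -⟩ := hδsub hz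
    exact ht0 z hzV (hfr z (hball z hzρ z hzρ).1 hzA)
  have heq : ∀ x ∈ ball x₀ (δ / 2), signedInfDist A x = t x := by
    intro x hx
    have hxδ : x ∈ ball x₀ δ := ball_subset_ball (by linarith) hx
    obtain ⟨r, hr, hrx⟩ := hsign x hxδ
    have hxU : x ∈ U := (hball x (hδsub hxδ).2.1 x (hδsub hxδ).2.1).1
    have hyA := hyfr x hxδ
    have hx₀' := hx₀
    rw [hA.frontier_eq] at hyA hx₀'
    -- The radius is halved because a nearest point is no farther from `x` than `x₀` is, hence stays
    -- in the ball of radius `δ`.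
    have hnear : ∀ z, dist x z ≤ dist x x₀ → z ∈ ball x₀ δ := fun z hz => by
      rw [mem_ball] at hx ⊢
      have := dist_triangle_left z x₀ x
      linarith
    by_cases hxA : x ∈ A
    · have htpos : 0 < t x := by
        have := (hAφ x hxU).1 hxA
        rw [hrx] at this
        exact (pos_iff_pos_of_mul_pos this).2 hr
      rw [signedInfDist_of_mem hxA]
      refine le_antisymm ?_ ?_
      · have := infDist_le_dist_of_mem (x := x) (show y x ∈ Aᶜ from hyA.2)
        rwa [hdist x hxδ, abs_of_pos htpos] at this
      · obtain ⟨z, hz, hzd⟩ := exists_mem_frontier_infDist_compl_eq_dist hxA hne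
        have hzδ := hnear z (hzd ▸ infDist_le_dist_of_mem (show x₀ ∈ Aᶜ from hx₀'.2))
        have := hlip x hxδ z hzδ
        rw [htz z hzδ hz, sub_zero, abs_of_pos htpos, ← hzd] at this
        exact this
    · have htneg : t x ≤ 0 := by
        have := (not_congr (hAφ x hxU)).1 hxA
        rw [hrx] at this
        by_contra! hcon
        exact this (by positivity)
      rw [signedInfDist_of_notMem hxA]
      have hAne : A.Nonempty := closure_nonempty_iff.1 ⟨x₀, hx₀'.1⟩
      have h1 : infDist x A ≤ |t x| := by
        rw [← infDist_closure, ← hdist x hxδ]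
        exact infDist_le_dist_of_mem hyA.1
      have h2 : |t x| ≤ infDist x A := by
        obtain ⟨z, hz, hzd⟩ := exists_mem_frontier_infDist_compl_eq_dist
          (show x ∈ Aᶜ from hxA) (fun h => hAne.ne_empty (compl_univ_iff.1 h))
        rw [frontier_compl] at hz
        rw [compl_compl] at hzd
        have hzδ := hnear z (by
          rw [← hzd, ← infDist_closure]
          exact infDist_le_dist_of_mem hx₀'.1)
        have := hlip x hxδ z hzδ
        rwa [htz z hzδ hz, sub_zero, ← hzd] at this
      rw [abs_of_nonpos htneg] at h1 h2
      linarith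
  refine ⟨ball x₀ (δ / 2), ⟨isOpen_ball, ?_, fun z hz => ?_⟩, mem_ball_self (by linarith)⟩
  · exact (ht.mono fun x hx => (hδsub (ball_subset_ball (by linarith) hx)).1).congr heq
  · have hzV : z ∈ V := (hδsub (ball_subset_ball (by linarith) hz)).1
    have : signedInfDist A =ᶠ[𝓝 z] t := by
      filter_upwards [isOpen_ball.mem_nhds hz] with w hw using heq w hw
    rw [((hgrad z hzV).congr_of_eventuallyEq this).gradient, hνn z hzV]

end RegularSet

/-! ### Principal curvatures and the Hessian of the distance. -/

section Curvature

variable {n : ℕ} {A : Set (EuclideanSpace ℝ (Fin n))} {x : EuclideanSpace ℝ (Fin n)}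

/-- Principal curvatures in terms of the second derivative of a defining function. -/
theorem curvature_eq_hessian {φ : EuclideanSpace ℝ (Fin n) → ℝ} (hφ : ContDiffAt ℝ 2 φ x)
    (hg : gradient φ x ≠ 0) {e : EuclideanSpace ℝ (Fin n)} (he : ‖e‖ = 1)
    (hperp : inner ℝ (gradient φ x) e = 0) {k : ℝ}
    (hk : -(fderiv ℝ (unitNormalField φ) x e) = k • e) :
    k = -(‖gradient φ x‖⁻¹ * fderiv ℝ (fderiv ℝ φ) x e e) := by
  have hd := hφ.differentiableAt_gradient
  have hr : DifferentiableAt ℝ (fun y => ‖gradient φ y‖⁻¹) x :=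
    (hd.norm ℝ hg).inv (norm_ne_zero_iff.2 hg)
  have h1 := hr.hasFDerivAt.fun_smul hd.hasFDerivAt
  have h2 : fderiv ℝ (unitNormalField φ) x = _ := h1.fderiv
  have h3 := congrArg (fun z => inner ℝ z e) hk
  simp only [h2, inner_neg_left, inner_smul_left, real_inner_self_eq_norm_sq, he] at h3
  -- The derivative of the factor `‖∇φ‖⁻¹` multiplies `∇φ`, which is orthogonal to `e`, and so drops
  -- out.
  simp only [FunLike.coe_add, FunLike.coe_smul, Pi.add_apply, Pi.smul_apply,
    ContinuousLinearMap.smulRight_apply, inner_add_left, inner_smul_left,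
    hφ.inner_fderiv_gradient, hperp] at h3
  simpa using h3.symm

theorem ContDiffAt.inner_fderiv_gradient_comm {f : EuclideanSpace ℝ (Fin n) → ℝ}
    (hf : ContDiffAt ℝ 2 f x) (v w : EuclideanSpace ℝ (Fin n)) :
    Inner.inner ℝ (fderiv ℝ (_root_.gradient f) x v) w =
      Inner.inner ℝ v (fderiv ℝ (_root_.gradient f) x w) := by
  rw [hf.inner_fderiv_gradient, real_inner_comm, hf.inner_fderiv_gradient]
  exact hf.isSymmSndFDerivAt (by simp) v w

theorem two_le_infty : (2 : WithTop ℕ∞) ≤ ∞ :=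
  WithTop.coe_le_coe.2 (le_top : (2 : ℕ∞) ≤ ⊤)

theorem inner_gradient_fderiv_gradient_signedInfDist (hx : x ∈ distRegularSet A)
    (v : EuclideanSpace ℝ (Fin n)) :
    inner ℝ (gradient (signedInfDist A) x) (fderiv ℝ (gradient (signedInfDist A)) x v) = 0 := by
  have hC := (contDiffAt_signedInfDist hx).of_le two_le_infty
  have h1 : HasFDerivAt (fun z => ‖gradient (signedInfDist A) z‖ ^ 2) _ x :=
    hC.differentiableAt_gradient.hasFDerivAt.norm_sq
  have h2 : HasFDerivAt (fun z => ‖gradient (signedInfDist A) z‖ ^ 2) (0 : _ →L[ℝ] ℝ) x :=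
    (hasFDerivAt_const (1 : ℝ) x).congr_of_eventuallyEq (by
      filter_upwards [isOpen_distRegularSet.mem_nhds hx] with z hz
      rw [norm_gradient_signedInfDist hz, one_pow])
  have := DFunLike.congr_fun (h1.unique h2) v
  simpa using this

theorem isLocalDefiningFunction_signedInfDist (hA : IsOpen A) (hne : A ≠ univ)
    (hx : x ∈ distRegularSet A) : IsLocalDefiningFunction A x (signedInfDist A) :=
  ⟨distRegularSet A, isOpen_distRegularSet, hx, contDiffOn_signedInfDist, fun y hy h => by
    have := norm_gradient_signedInfDist hy
    rw [h, norm_zero] at this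
    exact zero_ne_one this, fun _ _ => (signedInfDist_pos_iff hA hne).symm⟩

/-- Diagonalization of the second fundamental form by means of the signed distance. -/
theorem exists_principalCurvatures (hA : IsOpen A) (hne : A ≠ univ) (hx : x ∈ distRegularSet A) :
    ∃ (κ : Fin (n - 1) → ℝ) (f : Fin (n - 1) → EuclideanSpace ℝ (Fin n)),
      IsPrincipalCurvatures A x κ ∧ Orthonormal ℝ f ∧
      (∀ i, inner ℝ (gradient (signedInfDist A) x) (f i) = 0) ∧
      (∀ v, -fderiv ℝ (fderiv ℝ (signedInfDist A)) x v v = ∑ i, κ i * inner ℝ (f i) v ^ 2) ∧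
      ∀ i, κ i ≤ ‖fderiv ℝ (fderiv ℝ (signedInfDist A)) x‖ := by
  have hC := (contDiffAt_signedInfDist hx).of_le two_le_infty
  set ν := gradient (signedInfDist A) x with hν
  have hν1 : ‖ν‖ = 1 := norm_gradient_signedInfDist hx
  set T : EuclideanSpace ℝ (Fin n) →ₗ[ℝ] EuclideanSpace ℝ (Fin n) :=
    (-fderiv ℝ (gradient (signedInfDist A)) x).toLinearMap with hT
  have hTapp : ∀ v, T v = -fderiv ℝ (gradient (signedInfDist A)) x v := fun v => rfl
  have hTsymm : T.IsSymmetric := fun v w => by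
    rw [hTapp, hTapp, inner_neg_left, inner_neg_right, hC.inner_fderiv_gradient_comm]
  have hTν : ∀ v, inner ℝ ν (T v) = 0 := fun v => by
    rw [hTapp, inner_neg_right, inner_gradient_fderiv_gradient_signedInfDist hx, neg_zero]
  have hTν0 : T ν = 0 := by
    refine ext_inner_right ℝ fun v => ?_
    rw [hTsymm, hTν, inner_zero_left]
  -- `T` annihilates `ν` and maps into its complement, so the spectral theorem on that complement
  -- captures the whole quadratic form.
  set K := (Submodule.span ℝ {ν})ᗮ with hK
  have hmemK : ∀ v, v ∈ K ↔ inner ℝ ν v = 0 := fun v =>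
    Submodule.mem_orthogonal_singleton_iff_inner_right
  have hTK : ∀ v ∈ K, T v ∈ K := fun v _ => (hmemK _).2 (hTν v)
  have hdim : Module.finrank ℝ K = n - 1 := by
    have h1 := Submodule.finrank_add_finrank_orthogonal (Submodule.span ℝ {ν})
    rw [finrank_span_singleton (norm_ne_zero_iff.1 (by rw [hν1]; exact one_ne_zero)),
      finrank_euclideanSpace_fin, ← hK] at h1
    omega
  have hTKs := hTsymm.restrict_invariant hTK
  set b := hTKs.eigenvectorBasis hdim with hb
  set κ := hTKs.eigenvalues hdim with hκ
  have hTb : ∀ i, T (b i) = κ i • (b i : EuclideanSpace ℝ (Fin n)) := fun i =>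
    congrArg Subtype.val (hTKs.apply_eigenvectorBasis hdim i)
  have hbo : Orthonormal ℝ fun i => (b i : EuclideanSpace ℝ (Fin n)) :=
    b.orthonormal.comp_linearIsometry K.subtypeₗᵢ
  have hbν : ∀ i, inner ℝ ν (b i : EuclideanSpace ℝ (Fin n)) = 0 := fun i =>
    (hmemK _).1 (b i).2
  have hquad : ∀ v, -fderiv ℝ (fderiv ℝ (signedInfDist A)) x v v =
      ∑ i, κ i * inner ℝ (b i : EuclideanSpace ℝ (Fin n)) v ^ 2 := by
    intro v
    have hw : v - inner ℝ ν v • ν ∈ K := by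
      rw [hmemK, inner_sub_right, inner_smul_right, real_inner_self_eq_norm_sq, hν1]
      ring
    have hTw : T (v - inner ℝ ν v • ν) = T v := by
      rw [map_sub, map_smul, hTν0, smul_zero, sub_zero]
    set w : K := ⟨_, hw⟩ with hwdef
    have hbw : ∀ i, inner ℝ (b i) w = inner ℝ (b i : EuclideanSpace ℝ (Fin n)) v := fun i => by
      rw [Submodule.coe_inner, hwdef, inner_sub_right, inner_smul_right,
        real_inner_comm ν (b i : EuclideanSpace ℝ (Fin n)), hbν, mul_zero, sub_zero]
    have h1 : inner ℝ (T v) v = inner ℝ (T.restrict hTK w) w := by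
      rw [Submodule.coe_inner, LinearMap.coe_restrict_apply, hwdef, hTw, inner_sub_right,
        inner_smul_right, real_inner_comm ν (T v), hTν, mul_zero, sub_zero]
    have h2 : -fderiv ℝ (fderiv ℝ (signedInfDist A)) x v v = inner ℝ (T v) v := by
      rw [hTapp, inner_neg_left, hC.inner_fderiv_gradient]
    rw [h2, h1, ← b.sum_inner_mul_inner]
    refine Finset.sum_congr rfl fun i _ => ?_
    rw [hTKs w (b i), hTKs.apply_eigenvectorBasis hdim i, hbw, real_inner_comm,
      ← hbw, ← hb]
    change inner ℝ (κ i • b i) w * _ = _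
    rw [inner_smul_left]
    simp
    ring
  refine ⟨κ, fun i => b i, ?_, hbo, hbν, hquad, fun i => ?_⟩
  · refine ⟨_, isLocalDefiningFunction_signedInfDist hA hne hx, fun i => b i, hbo, fun i =>
      ⟨hbν i, ?_⟩⟩
    have : unitNormalField (signedInfDist A) =ᶠ[𝓝 x] gradient (signedInfDist A) := by
      filter_upwards [isOpen_distRegularSet.mem_nhds hx] with z hz
      rw [unitNormalField, norm_gradient_signedInfDist hz, inv_one, one_smul]
    rw [this.fderiv_eq]
    exact hTb i
  · have h1 : κ i = inner ℝ (T (b i)) (b i : EuclideanSpace ℝ (Fin n)) := by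
      rw [hTb, inner_smul_left, real_inner_self_eq_norm_sq, hbo.1 i]
      simp
    rw [h1, hTapp, inner_neg_left, hC.inner_fderiv_gradient]
    refine (neg_le_abs _).trans ?_
    have := (fderiv ℝ (fderiv ℝ (signedInfDist A)) x).le_opNorm₂
      (b i : EuclideanSpace ℝ (Fin n)) (b i)
    rwa [hbo.1 i, mul_one, mul_one] at this

/-- Translating `x` and its foot point `y` by the same `v` keeps their distance. This one inequality
replaces the evolution of curvatures along parallel surfaces. -/
theorem signedInfDist_touching (hA : IsOpen A) {y : EuclideanSpace ℝ (Fin n)}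
    (hxy : dist x y = signedInfDist A x) (v : EuclideanSpace ℝ (Fin n)) :
    signedInfDist A (x + v) ≤ signedInfDist A x + signedInfDist A (y + v) := by
  have := signedInfDist_le_add_dist hA (x + v) (y + v)
  rwa [dist_add_right, hxy] at this

/-- The signed distance, made more concave in the normal direction. -/
noncomputable def expDist (A : Set (EuclideanSpace ℝ (Fin n))) (c : ℝ)
    (x : EuclideanSpace ℝ (Fin n)) : ℝ :=
  1 - Real.exp (-c * signedInfDist A x)

theorem hasFDerivAt_expDist (c : ℝ) (hx : DifferentiableAt ℝ (signedInfDist A) x) :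
    HasFDerivAt (expDist A c)
      ((c * Real.exp (-c * signedInfDist A x)) • fderiv ℝ (signedInfDist A) x) x := by
  have h1 := ((hx.hasFDerivAt.const_mul (-c)).exp.const_sub 1)
  refine h1.congr_fderiv ?_
  ext v
  simp
  ring

theorem contDiffOn_expDist (c : ℝ) : ContDiffOn ℝ ∞ (expDist A c) (distRegularSet A) :=
  contDiffOn_const.sub (contDiffOn_const.mul contDiffOn_signedInfDist).exp

theorem hessian_expDist (c : ℝ) (hx : x ∈ distRegularSet A) (v : EuclideanSpace ℝ (Fin n)) :
    -fderiv ℝ (fderiv ℝ (expDist A c)) x v v = c * Real.exp (-c * signedInfDist A x) *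
      (-fderiv ℝ (fderiv ℝ (signedInfDist A)) x v v +
        c * inner ℝ (gradient (signedInfDist A) x) v ^ 2) := by
  have hC := (contDiffAt_signedInfDist hx).of_le two_le_infty
  have hd := hC.differentiableAt (by simp)
  have h1 : fderiv ℝ (expDist A c) =ᶠ[𝓝 x] fun z =>
      (c * Real.exp (-c * signedInfDist A z)) • fderiv ℝ (signedInfDist A) z := by
    filter_upwards [isOpen_distRegularSet.mem_nhds hx] with z hz
    exact (hasFDerivAt_expDist c
      ((contDiffAt_signedInfDist hz).differentiableAt (by simp))).fderiv
  have h2 := (((hd.hasFDerivAt.const_mul (-c)).exp.const_mul c).fun_smul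
    hC.differentiableAt_fderiv.hasFDerivAt).congr_of_eventuallyEq h1
  rw [h2.fderiv, inner_gradient_left]
  simp
  ring

/-- The second derivative of `expDist` satisfies the curvature condition on all hyperplanes. -/
theorem hessian_expDist_mem {Γ : Set (Fin (n - 1) → ℝ)} (hΓ : IsCurvatureCone Γ) (hn : 0 < n)
    (hA : IsOpen A) (hA' : HasSmoothBoundary A) (hne : A ≠ univ)
    (hAΓ : PrincipalCurvaturesIn A Γ) {c : ℝ} (hc0 : 0 < c)
    (hx : x ∈ distRegularSet A) (hxA : x ∈ closure A)
    (hc : ∀ y ∈ frontier A, dist x y = signedInfDist A x →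
      ‖fderiv ℝ (fderiv ℝ (signedInfDist A)) y‖ ≤ c)
    {e : Fin (n - 1) → EuclideanSpace ℝ (Fin n)} (he : Orthonormal ℝ e) :
    (fun i => -fderiv ℝ (fderiv ℝ (expDist A c)) x (e i) (e i)) ∈ Γ := by
  obtain ⟨y, hy, hxy⟩ := exists_mem_frontier_dist_eq_signedInfDist hA hne hxA
  have hyR := frontier_subset_distRegularSet hA hA' hne hy
  have hCx := (contDiffAt_signedInfDist hx).of_le two_le_infty
  have hCy := (contDiffAt_signedInfDist hyR).of_le two_le_infty
  have hy0 := signedInfDist_of_mem_frontier hA hy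
  have htouch : ∀ᶠ v in 𝓝 (0 : EuclideanSpace ℝ (Fin n)), signedInfDist A (x + v) ≤
      (fun z => signedInfDist A x + signedInfDist A z) (y + v) :=
    Eventually.of_forall fun v => signedInfDist_touching hA hxy v
  have hCy' : ContDiffAt ℝ 2 (fun z => signedInfDist A x + signedInfDist A z) y :=
    contDiffAt_const.add hCy
  have hfd : fderiv ℝ (fun z => signedInfDist A x + signedInfDist A z) =
      fderiv ℝ (signedInfDist A) := by
    ext1 z
    exact fderiv_const_add _
  have hgrad : gradient (signedInfDist A) x = gradient (signedInfDist A) y := by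
    have := fderiv_eq_of_touching (hCx.differentiableAt (by simp))
      (hCy'.differentiableAt (by simp)) htouch (by simp [hy0])
    rw [hfd] at this
    rw [gradient, gradient, this]
  have hhess : ∀ v, fderiv ℝ (fderiv ℝ (signedInfDist A)) x v v ≤
      fderiv ℝ (fderiv ℝ (signedInfDist A)) y v v := fun v => by
    have := hessian_le_of_touching hCx hCy' htouch (by simp [hy0]) v
    rwa [hfd] at this
  obtain ⟨κ, f, hκ, hf, hνf, hquad, hbound⟩ := exists_principalCurvatures hA hne hyR
  -- At the foot point the form has eigenvalues `κ` on the tangent space; the added normal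
  -- eigenvalue `c` dominates them through the Hessian bound.
  have hmem := hΓ.diagonal_mem (by rw [finrank_euclideanSpace_fin]; omega) (hAΓ y hy κ hκ)
    (fun i => (hbound i).trans (hc y hy hxy)) hf he (norm_gradient_signedInfDist hyR) hνf
  have hmem2 := hΓ.mem_of_le hmem
    (κ' := fun i => -fderiv ℝ (fderiv ℝ (signedInfDist A)) x (e i) (e i) +
      c * inner ℝ (gradient (signedInfDist A) x) (e i) ^ 2) fun i => by
    rw [hgrad, ← hquad]
    have := hhess (e i)
    linarith
  have := hΓ.smul_mem (c * Real.exp (-c * signedInfDist A x)) (by positivity) _ hmem2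
  convert this using 1
  ext i
  simp [hessian_expDist c hx]

end Curvature

/-! ### The smoothed minimum and generic parameters. -/

section SmoothMin

/-- A smooth concave approximation of `min a b`, exact for `s ≤ |a - b|`; it is jointly concave and
positively homogeneous in `(s, a, b)`. -/
noncomputable def smoothMin (s a b : ℝ) : ℝ := (a + b) / 2 - s * smoothHalfAbs ((a - b) / s)

variable {s a b : ℝ}

/-- The supporting line of `smoothHalfAbs` at `t`, scaled by `s`, becomes linear in `(s, a, b)`. Its
coefficients of `a` and `b` are nonnegative with sum one. -/
theorem smoothMin_le_tangent (t : ℝ) (hs : 0 < s) : smoothMin s a b ≤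
    (1 / 2 - smoothHalfSign t) * a + (1 / 2 + smoothHalfSign t) * b -
      (smoothHalfAbs t - t * smoothHalfSign t) * s := by
  have h := mul_le_mul_of_nonneg_left (smoothHalfAbs_tangent_le t ((a - b) / s)) hs.le
  have h2 : s * ((a - b) / s) = a - b := by field_simp
  have h3 : s * (smoothHalfAbs t + smoothHalfSign t * ((a - b) / s - t)) =
      s * smoothHalfAbs t + smoothHalfSign t * (a - b) - s * smoothHalfSign t * t := by
    linear_combination smoothHalfSign t * h2
  unfold smoothMin
  linarith

theorem smoothMin_eq_tangent (hs : 0 < s) : smoothMin s a b =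
    (1 / 2 - smoothHalfSign ((a - b) / s)) * a + (1 / 2 + smoothHalfSign ((a - b) / s)) * b -
      (smoothHalfAbs ((a - b) / s) - (a - b) / s * smoothHalfSign ((a - b) / s)) * s := by
  have h2 : (a - b) / s * s = a - b := by field_simp
  unfold smoothMin
  linear_combination (-smoothHalfSign ((a - b) / s)) * h2

theorem smoothMin_le_left (hs : 0 < s) : smoothMin s a b ≤ a := by
  have h := smoothMin_le_tangent (a := a) (b := b) (-1) hs
  rw [smoothHalfAbs_of_le_neg_one le_rfl, smoothHalfSign_of_le_neg_one le_rfl] at h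
  linarith

theorem smoothMin_le_right (hs : 0 < s) : smoothMin s a b ≤ b := by
  have h := smoothMin_le_tangent (a := a) (b := b) 1 hs
  rw [smoothHalfAbs_of_one_le le_rfl, smoothHalfSign_of_one_le le_rfl] at h
  linarith

theorem smoothMin_eq_left (hs : 0 < s) (h : s ≤ b - a) : smoothMin s a b = a := by
  rw [smoothMin, smoothHalfAbs_of_le_neg_one (by rw [div_le_iff₀ hs]; linarith)]
  field_simp
  ring

theorem smoothMin_eq_right (hs : 0 < s) (h : s ≤ a - b) : smoothMin s a b = b := by
  rw [smoothMin, smoothHalfAbs_of_one_le (by rw [le_div_iff₀ hs]; linarith)]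
  field_simp
  ring

/-- This localizes the rounding: for nonnegative `a` and `b`, both are at most `s`. -/
theorem add_le_of_smoothMin_nonpos (hs : 0 < s) (h : |a - b| ≤ s) (h0 : smoothMin s a b ≤ 0) :
    a + b ≤ s := by
  have h1 : smoothHalfAbs ((a - b) / s) ≤ 1 / 2 :=
    smoothHalfAbs_le (by rwa [abs_div, abs_of_pos hs, div_le_one hs])
  unfold smoothMin at h0
  nlinarith

/-- `smoothMin` is strictly decreasing in the smoothing parameter, where it is not the minimum. -/
theorem smoothMin_lt_of_lt {r : ℝ} (hs : 0 < s) (h : |a - b| < s) (hr : s < r) :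
    smoothMin r a b < smoothMin s a b := by
  have h1 := smoothMin_le_tangent (a := a) (b := b) ((a - b) / s) (hs.trans hr)
  have h2 := smoothMin_eq_tangent (a := a) (b := b) hs
  have h3 := smoothHalfAbs_intercept_pos (t := (a - b) / s)
    (by rwa [abs_div, abs_of_pos hs, div_lt_one hs])
  nlinarith

variable {n : ℕ} {f g : EuclideanSpace ℝ (Fin n) → ℝ} {R : Set (EuclideanSpace ℝ (Fin n))}

/-- By strict monotonicity in the smoothing parameter, each point `x` admits at most one value of
it; Fubini does the rest. -/
theorem volume_smoothMin_eq_zero (hf : Continuous f) (hg : Continuous g) :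
    MeasureTheory.volume {q : EuclideanSpace ℝ (Fin n) × ℝ | 0 < q.2 ∧ |f q.1 - g q.1| < q.2 ∧
      smoothMin q.2 (f q.1) (g q.1) = 0} = 0 := by
  have hψ : Measurable smoothHalfAbs := contDiff_smoothHalfAbs.continuous.measurable
  have hf' : Measurable fun q : EuclideanSpace ℝ (Fin n) × ℝ => f q.1 :=
    hf.measurable.comp measurable_fst
  have hg' : Measurable fun q : EuclideanSpace ℝ (Fin n) × ℝ => g q.1 :=
    hg.measurable.comp measurable_fst
  have hmeas : MeasurableSet {q : EuclideanSpace ℝ (Fin n) × ℝ | 0 < q.2 ∧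
      |f q.1 - g q.1| < q.2 ∧ smoothMin q.2 (f q.1) (g q.1) = 0} := by
    refine (measurableSet_lt measurable_const measurable_snd).inter
      ((measurableSet_lt ?_ measurable_snd).inter (measurableSet_eq_fun ?_ measurable_const))
    · exact (continuous_abs.measurable.comp (hf'.sub hg'))
    · exact ((hf'.add hg').div_const 2).sub
        (measurable_snd.mul (hψ.comp ((hf'.sub hg').div measurable_snd)))
  rw [MeasureTheory.Measure.volume_eq_prod, MeasureTheory.Measure.measure_prod_null hmeas]
  refine Eventually.of_forall fun x => Set.Subsingleton.measure_zero ?_ _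
  rintro r ⟨hr0, hr1, hr2⟩ s ⟨hs0, hs1, hs2⟩
  simp only at hr0 hr1 hr2 hs0 hs1 hs2
  rcases lt_trichotomy r s with h | h | h
  · have := smoothMin_lt_of_lt hr0 hr1 h
    linarith
  · exact h
  · have := smoothMin_lt_of_lt hs0 hs1 h
    linarith

/-- For generic affine smoothing parameters `q.2 + ⟪q.1, x⟫`, the gradient of the smoothed minimum
of `f` and `g` does not vanish on its zero set. -/
theorem exists_regular_parameter (hf : Continuous f) (hg : Continuous g) (hR : IsOpen R)
    (hfR : ContDiffOn ℝ ∞ f R) (hgR : ContDiffOn ℝ ∞ g R)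
    {O : Set (EuclideanSpace ℝ (Fin n) × ℝ)} (hO : IsOpen O) (hOne : O.Nonempty) :
    ∃ q ∈ O, ∀ x ∈ R, ∀ s t : ℝ, s = q.2 + inner ℝ q.1 x → t = (f x - g x) / s → 0 < s →
      |f x - g x| < s → smoothMin s (f x) (g x) = 0 →
      (1 / 2 - smoothHalfSign t) • gradient f x + (1 / 2 + smoothHalfSign t) • gradient g x -
        (smoothHalfAbs t - t * smoothHalfSign t) • q.1 ≠ 0 := by
  set T : EuclideanSpace ℝ (Fin n) × ℝ → ℝ := fun q => (f q.1 - g q.1) / q.2 with hT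
  -- `P` solves the critical point equation for `q.1`, the intercept being positive. Then `q.2` is
  -- recovered from the value of the parameter at the point, so bad parameters lie in `Φ '' Z`.
  set P : EuclideanSpace ℝ (Fin n) × ℝ → EuclideanSpace ℝ (Fin n) := fun q =>
    (smoothHalfAbs (T q) - T q * smoothHalfSign (T q))⁻¹ •
      ((1 / 2 - smoothHalfSign (T q)) • gradient f q.1 +
        (1 / 2 + smoothHalfSign (T q)) • gradient g q.1) with hP
  set Φ : EuclideanSpace ℝ (Fin n) × ℝ → EuclideanSpace ℝ (Fin n) × ℝ := fun q =>
    (P q, q.2 - inner ℝ (P q) q.1) with hΦ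
  set Z : Set (EuclideanSpace ℝ (Fin n) × ℝ) := {q | 0 < q.2 ∧ |f q.1 - g q.1| < q.2 ∧
      smoothMin q.2 (f q.1) (g q.1) = 0} ∩ {q | q.1 ∈ R} with hZ
  have hZ0 : MeasureTheory.volume Z = 0 :=
    MeasureTheory.measure_mono_null inter_subset_left (volume_smoothMin_eq_zero hf hg)
  have hTabs : ∀ q ∈ Z, |T q| < 1 := fun q hq => by
    rw [hT, abs_div, abs_of_pos hq.1.1, div_lt_one hq.1.1]
    exact hq.1.2.1
  have hdiff : DifferentiableOn ℝ Φ Z := by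
    intro q hq
    refine DifferentiableAt.differentiableWithinAt ?_
    have hqR : R ∈ 𝓝 q.1 := hR.mem_nhds hq.2
    have hfst : DifferentiableAt ℝ (Prod.fst : EuclideanSpace ℝ (Fin n) × ℝ → _) q :=
      differentiableAt_fst
    have df : DifferentiableAt ℝ (fun q : EuclideanSpace ℝ (Fin n) × ℝ => f q.1) q :=
      ((hfR.contDiffAt hqR).differentiableAt (by simp)).comp q hfst
    have dg : DifferentiableAt ℝ (fun q : EuclideanSpace ℝ (Fin n) × ℝ => g q.1) q :=
      ((hgR.contDiffAt hqR).differentiableAt (by simp)).comp q hfst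
    have dgf : DifferentiableAt ℝ (fun q : EuclideanSpace ℝ (Fin n) × ℝ => gradient f q.1) q :=
      ((hfR.contDiffAt hqR).of_le two_le_infty).differentiableAt_gradient.comp q hfst
    have dgg : DifferentiableAt ℝ (fun q : EuclideanSpace ℝ (Fin n) × ℝ => gradient g q.1) q :=
      ((hgR.contDiffAt hqR).of_le two_le_infty).differentiableAt_gradient.comp q hfst
    have dT : DifferentiableAt ℝ T q := by
      simp only [hT, div_eq_mul_inv]
      exact (df.fun_sub dg).fun_mul (differentiableAt_snd.fun_inv hq.1.1.ne')
    have dψ : DifferentiableAt ℝ (fun q => smoothHalfAbs (T q)) q :=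
      (hasDerivAt_smoothHalfAbs _).differentiableAt.comp q dT
    have dθ : DifferentiableAt ℝ (fun q => smoothHalfSign (T q)) q :=
      (contDiff_smoothHalfSign.differentiable (by simp)).differentiableAt.comp q dT
    have dP : DifferentiableAt ℝ P q :=
      ((dψ.sub (dT.mul dθ)).inv (smoothHalfAbs_intercept_pos (hTabs q hq)).ne').smul
        (((dθ.const_sub _).smul dgf).add ((dθ.const_add _).smul dgg))
    exact dP.prodMk (differentiableAt_snd.sub (dP.inner ℝ hfst))
  have hHaar : (MeasureTheory.volume :
      MeasureTheory.Measure (EuclideanSpace ℝ (Fin n) × ℝ)).IsAddHaarMeasure := by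
    rw [MeasureTheory.Measure.volume_eq_prod]
    infer_instance
  have himg : MeasureTheory.volume (Φ '' Z) = 0 :=
    MeasureTheory.addHaar_image_eq_zero_of_differentiableOn_of_addHaar_eq_zero _ hdiff hZ0
  obtain ⟨q, hqO, hqZ⟩ : ∃ q ∈ O, q ∉ Φ '' Z := by
    by_contra! hsub
    exact (hO.measure_pos MeasureTheory.volume hOne).ne'
      (MeasureTheory.measure_mono_null hsub himg)
  refine ⟨q, hqO, ?_⟩
  rintro x hx s t hs rfl hs0 hlt hzero heq
  refine hqZ ⟨(x, s), ⟨⟨hs0, hlt, hzero⟩, hx⟩, ?_⟩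
  have hPq : P (x, s) = q.1 := by
    have hpos := smoothHalfAbs_intercept_pos (hTabs (x, s) ⟨⟨hs0, hlt, hzero⟩, hx⟩)
    rw [hP]
    simp only [hT] at hpos ⊢
    rw [sub_eq_zero.1 heq, smul_smul, inv_mul_cancel₀ hpos.ne', one_smul]
  ext1
  · exact hPq
  · simp only [hΦ, hPq]
    rw [hs, add_sub_cancel_right]

end SmoothMin

theorem IsCompact.exists_pos_forall_le_imp_mem {X : Type*} [TopologicalSpace X] {K W : Set X}
    (hK : IsCompact K) (hW : IsOpen W) {f : X → ℝ} (hf : Continuous f) (hpos : ∀ x ∈ K, 0 ≤ f x)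
    (h : ∀ x ∈ K, f x = 0 → x ∈ W) : ∃ η > 0, ∀ x ∈ K, f x ≤ η → x ∈ W := by
  rcases (K \ W).eq_empty_or_nonempty with he | hne
  · exact ⟨1, one_pos, fun x hx _ => sdiff_eq_empty.1 he hx⟩
  · obtain ⟨x₀, hx₀, hmin⟩ := (hK.diff hW).exists_isMinOn hne hf.continuousOn
    have h0 : 0 < f x₀ := (hpos x₀ hx₀.1).lt_of_ne fun h' => hx₀.2 (h x₀ hx₀.1 h'.symm)
    refine ⟨f x₀ / 2, half_pos h0, fun x hx hfx => ?_⟩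
    by_contra hxW
    have : f x₀ ≤ f x := hmin ⟨hx, hxW⟩
    linarith

/-! ### Locality of boundaries and curvatures. -/

section LocalCongr

variable {n : ℕ} {A B : Set (EuclideanSpace ℝ (Fin n))} {x : EuclideanSpace ℝ (Fin n)}

theorem mem_frontier_congr (h : ∀ᶠ z in 𝓝 x, z ∈ A ↔ z ∈ B) (hx : x ∈ frontier A) :
    x ∈ frontier B := by
  rw [frontier_eq_closure_inter_closure, mem_inter_iff, mem_closure_iff_frequently,
    mem_closure_iff_frequently] at hx ⊢
  exact ⟨(hx.1.and_eventually h).mono fun z hz => hz.2.1 hz.1,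
    (hx.2.and_eventually h).mono fun z hz hzB => hz.1 (hz.2.2 hzB)⟩

theorem IsLocalDefiningFunction.congr {φ : EuclideanSpace ℝ (Fin n) → ℝ}
    (h : ∀ᶠ z in 𝓝 x, z ∈ A ↔ z ∈ B) (hφ : IsLocalDefiningFunction A x φ) :
    IsLocalDefiningFunction B x φ := by
  obtain ⟨U, hU, hxU, hC, hg, hA⟩ := hφ
  obtain ⟨V, hV, hVo, hxV⟩ := _root_.eventually_nhds_iff.1 h
  exact ⟨U ∩ V, hU.inter hVo, ⟨hxU, hxV⟩, hC.mono inter_subset_left, fun y hy => hg y hy.1,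
    fun y hy => (hV y hy.2).symm.trans (hA y hy.1)⟩

theorem IsPrincipalCurvatures.congr {κ : Fin (n - 1) → ℝ} (h : ∀ᶠ z in 𝓝 x, z ∈ A ↔ z ∈ B)
    (hκ : IsPrincipalCurvatures A x κ) : IsPrincipalCurvatures B x κ := by
  obtain ⟨φ, hφ, he⟩ := hκ
  exact ⟨φ, hφ.congr h, he⟩

end LocalCongr

/-! ### Sign and gradient of `expDist`. -/

section ExpDist

variable {n : ℕ} {A : Set (EuclideanSpace ℝ (Fin n))} {x : EuclideanSpace ℝ (Fin n)} {c : ℝ}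

theorem continuous_expDist (c : ℝ) : Continuous (expDist A c) :=
  continuous_const.sub
    (Real.continuous_exp.comp (continuous_const.mul (continuous_signedInfDist A)))

theorem expDist_nonneg (hc : 0 < c) (h : 0 ≤ signedInfDist A x) : 0 ≤ expDist A c x := by
  rw [expDist, sub_nonneg, Real.exp_le_one_iff]
  nlinarith

theorem expDist_pos_iff (hc : 0 < c) (hA : IsOpen A) (hne : A ≠ univ) :
    0 < expDist A c x ↔ x ∈ A := by
  rw [expDist, sub_pos, Real.exp_lt_one_iff, neg_mul, neg_lt_zero, mul_pos_iff_of_pos_left hc,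
    signedInfDist_pos_iff hA hne]

theorem signedInfDist_le_of_expDist_le (hc : 0 < c) {η : ℝ}
    (h : expDist A c x ≤ 1 - Real.exp (-c * η)) : signedInfDist A x ≤ η := by
  rw [expDist, sub_le_sub_iff_left, Real.exp_le_exp] at h
  nlinarith

theorem gradient_expDist_ne_zero (hc : 0 < c) (hx : x ∈ distRegularSet A) :
    gradient (expDist A c) x ≠ 0 := by
  rw [gradient_ne_zero_iff,
    (hasFDerivAt_expDist c ((contDiffAt_signedInfDist hx).differentiableAt (by simp))).fderiv]
  refine smul_ne_zero (by positivity) (gradient_ne_zero_iff.1 fun h => ?_)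
  have := norm_gradient_signedInfDist hx
  rw [h, norm_zero] at this
  exact zero_ne_one this

end ExpDist

/-! ### Tangent majorants with affine smoothing parameter. -/

section Tangent

variable {n : ℕ} {f g : EuclideanSpace ℝ (Fin n) → ℝ} {R : Set (EuclideanSpace ℝ (Fin n))}
  {x : EuclideanSpace ℝ (Fin n)}

theorem hasFDerivAt_affineComb (α β γ : ℝ) (q : EuclideanSpace ℝ (Fin n) × ℝ)
    (hf : DifferentiableAt ℝ f x) (hg : DifferentiableAt ℝ g x) :
    HasFDerivAt (fun z => α * f z + β * g z - γ * (q.2 + inner ℝ q.1 z))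
      (α • fderiv ℝ f x + β • fderiv ℝ g x - γ • innerSL ℝ q.1) x :=
  ((hf.hasFDerivAt.const_mul α).add (hg.hasFDerivAt.const_mul β)).sub
    (((innerSL ℝ q.1).hasFDerivAt.const_add q.2).const_mul γ)

theorem gradient_affineComb (α β γ : ℝ) (q : EuclideanSpace ℝ (Fin n) × ℝ)
    (hf : DifferentiableAt ℝ f x) (hg : DifferentiableAt ℝ g x) :
    gradient (fun z => α * f z + β * g z - γ * (q.2 + inner ℝ q.1 z)) x =
      α • gradient f x + β • gradient g x - γ • q.1 := by
  refine ext_inner_right ℝ fun v => ?_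
  rw [inner_gradient_left, (hasFDerivAt_affineComb α β γ q hf hg).fderiv]
  simp [inner_sub_left, inner_add_left, inner_smul_left, inner_gradient_left]

theorem hessian_affineComb (α β γ : ℝ) (q : EuclideanSpace ℝ (Fin n) × ℝ) (hR : IsOpen R)
    (hf : ContDiffOn ℝ ∞ f R) (hg : ContDiffOn ℝ ∞ g R) (hx : x ∈ R)
    (v : EuclideanSpace ℝ (Fin n)) :
    fderiv ℝ (fderiv ℝ fun z => α * f z + β * g z - γ * (q.2 + inner ℝ q.1 z)) x v v =
      α * fderiv ℝ (fderiv ℝ f) x v v + β * fderiv ℝ (fderiv ℝ g) x v v := by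
  have h1 : (fderiv ℝ fun z => α * f z + β * g z - γ * (q.2 + inner ℝ q.1 z)) =ᶠ[𝓝 x] fun z =>
      α • fderiv ℝ f z + β • fderiv ℝ g z - γ • innerSL ℝ q.1 := by
    filter_upwards [hR.mem_nhds hx] with z hz
    exact (hasFDerivAt_affineComb α β γ q
      ((hf.contDiffAt (hR.mem_nhds hz)).differentiableAt (by simp))
      ((hg.contDiffAt (hR.mem_nhds hz)).differentiableAt (by simp))).fderiv
  have hf2 := ((hf.contDiffAt (hR.mem_nhds hx)).of_le two_le_infty).differentiableAt_fderiv
  have hg2 := ((hg.contDiffAt (hR.mem_nhds hx)).of_le two_le_infty).differentiableAt_fderiv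
  have h2 := (((hf2.hasFDerivAt.const_smul α).add (hg2.hasFDerivAt.const_smul β)).sub_const
    (γ • innerSL ℝ q.1)).congr_of_eventuallyEq h1
  rw [h2.fderiv]
  simp

theorem contDiffOn_affineComb (α β γ : ℝ) (q : EuclideanSpace ℝ (Fin n) × ℝ)
    (hf : ContDiffOn ℝ ∞ f R) (hg : ContDiffOn ℝ ∞ g R) :
    ContDiffOn ℝ ∞ (fun z => α * f z + β * g z - γ * (q.2 + inner ℝ q.1 z)) R :=
  ((contDiffOn_const.mul hf).add (contDiffOn_const.mul hg)).sub
    (contDiffOn_const.mul (contDiffOn_const.add (contDiffOn_const.inner ℝ contDiffOn_id)))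

/-- The smoothed minimum of `f` and `g` with affine smoothing parameter `q.2 + ⟪q.1, z⟫`. -/
noncomputable def affineSmoothMin (q : EuclideanSpace ℝ (Fin n) × ℝ)
    (f g : EuclideanSpace ℝ (Fin n) → ℝ) (z : EuclideanSpace ℝ (Fin n)) : ℝ :=
  smoothMin (q.2 + inner ℝ q.1 z) (f z) (g z)

variable {q : EuclideanSpace ℝ (Fin n) × ℝ}

theorem isOpen_affine_pos (q : EuclideanSpace ℝ (Fin n) × ℝ) :
    IsOpen {z : EuclideanSpace ℝ (Fin n) | 0 < q.2 + inner ℝ q.1 z} :=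
  isOpen_lt continuous_const (by fun_prop)

theorem contDiffOn_affineSmoothMin (hf : ContDiffOn ℝ ∞ f R) (hg : ContDiffOn ℝ ∞ g R)
    (hpos : ∀ z ∈ R, 0 < q.2 + inner ℝ q.1 z) : ContDiffOn ℝ ∞ (affineSmoothMin q f g) R := by
  have hs : ContDiffOn ℝ ∞ (fun z : EuclideanSpace ℝ (Fin n) => q.2 + inner ℝ q.1 z) R :=
    contDiffOn_const.add (contDiffOn_const.inner ℝ contDiffOn_id)
  exact ((hf.add hg).div_const 2).sub (hs.mul
    (contDiff_smoothHalfAbs.comp_contDiffOn ((hf.sub hg).div hs fun z hz => (hpos z hz).ne')))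

theorem continuousOn_affineSmoothMin (hf : Continuous f) (hg : Continuous g) :
    ContinuousOn (affineSmoothMin q f g) {z | 0 < q.2 + inner ℝ q.1 z} := by
  have hs : Continuous (fun z : EuclideanSpace ℝ (Fin n) => q.2 + inner ℝ q.1 z) := by fun_prop
  exact ((hf.add hg).div_const 2).continuousOn.sub (hs.continuousOn.mul
    (contDiff_smoothHalfAbs.continuous.comp_continuousOn
      ((hf.sub hg).continuousOn.div hs.continuousOn fun z hz => ne_of_gt hz)))

/-- At a zero of the smoothed minimum, it is touched from above by a convex combination of `f` and
`g` up to an affine function. -/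
theorem affineSmoothMin_touching (hs : 0 < q.2 + inner ℝ q.1 x) :
    ∃ α β γ t : ℝ, t = (f x - g x) / (q.2 + inner ℝ q.1 x) ∧
      α = 1 / 2 - smoothHalfSign t ∧ β = 1 / 2 + smoothHalfSign t ∧
      γ = smoothHalfAbs t - t * smoothHalfSign t ∧
      affineSmoothMin q f g x = α * f x + β * g x - γ * (q.2 + inner ℝ q.1 x) ∧
      ∀ᶠ z in 𝓝 x, affineSmoothMin q f g z ≤ α * f z + β * g z - γ * (q.2 + inner ℝ q.1 z) := by
  refine ⟨_, _, _, _, rfl, rfl, rfl, rfl, smoothMin_eq_tangent hs, ?_⟩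
  filter_upwards [(isOpen_affine_pos q).mem_nhds hs] with z hz
  exact smoothMin_le_tangent _ hz

end Tangent

/-! ### Uniform constants and the smoothing of the intersection. -/

section Main

variable {n : ℕ} {A B : Set (EuclideanSpace ℝ (Fin n))}

/-- Foot points within distance one of `K` lie in a compact part of the frontier. This allows `c` to
be fixed independently of the smoothing scale, which only has to be at most one. -/
theorem HasSmoothBoundary.exists_hessian_bound (hA : IsOpen A) (hA' : HasSmoothBoundary A)
    (hne : A ≠ univ) {K : Set (EuclideanSpace ℝ (Fin n))} (hK : IsCompact K) :
    ∃ C : ℝ, ∀ x ∈ K, ∀ y ∈ frontier A, dist x y ≤ 1 →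
      ‖fderiv ℝ (fderiv ℝ (signedInfDist A)) y‖ ≤ C := by
  have hcont : ContinuousOn (fderiv ℝ (fderiv ℝ (signedInfDist A))) (distRegularSet A) :=
    ((contDiffOn_signedInfDist.fderiv_of_isOpen (m := ∞) isOpen_distRegularSet
      le_rfl).fderiv_of_isOpen (m := 0) isOpen_distRegularSet (by simp)).continuousOn
  have hcomp : IsCompact (cthickening 1 K ∩ frontier A) :=
    hK.cthickening.inter_right isClosed_frontier
  obtain ⟨C, hC⟩ := hcomp.exists_bound_of_continuousOn
    (f := fderiv ℝ (fderiv ℝ (signedInfDist A)))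
    (hcont.mono (inter_subset_right.trans (frontier_subset_distRegularSet hA hA' hne)))
  refine ⟨C, fun x hx y hy hxy => hC y ⟨?_, hy⟩⟩
  exact mem_cthickening_of_dist_le y x 1 K hx (by rwa [dist_comm])

theorem exists_smoothing_scale (hA : IsOpen A) (hB : IsOpen B)
    (hA' : HasSmoothBoundary A) (hB' : HasSmoothBoundary B) (hAne : A ≠ univ) (hBne : B ≠ univ)
    {K : Set (EuclideanSpace ℝ (Fin n))} (hK : IsCompact K) (hKA : K ⊆ closure A)
    (hKB : K ⊆ closure B) {ε : ℝ} (hε : 0 < ε) :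
    ∃ η > 0, η ≤ 1 ∧ ∀ x ∈ K, (signedInfDist A x ≤ η → x ∈ distRegularSet A) ∧
      (signedInfDist B x ≤ η → x ∈ distRegularSet B) ∧
      (signedInfDist A x ≤ η → signedInfDist B x ≤ η →
        x ∈ thickening ε (frontier A ∩ frontier B)) := by
  have hA0 : ∀ x ∈ K, 0 ≤ signedInfDist A x := fun x hx =>
    signedInfDist_nonneg_of_mem_closure (hKA hx)
  have hB0 : ∀ x ∈ K, 0 ≤ signedInfDist B x := fun x hx =>
    signedInfDist_nonneg_of_mem_closure (hKB hx)
  have hAf : ∀ x ∈ K, signedInfDist A x = 0 → x ∈ frontier A := fun x hx h =>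
    mem_frontier_of_signedInfDist_eq_zero hA hAne (hKA hx) h
  have hBf : ∀ x ∈ K, signedInfDist B x = 0 → x ∈ frontier B := fun x hx h =>
    mem_frontier_of_signedInfDist_eq_zero hB hBne (hKB hx) h
  obtain ⟨η₁, h₁, H₁⟩ := hK.exists_pos_forall_le_imp_mem (isOpen_distRegularSet (A := A))
    (continuous_signedInfDist A) hA0
    fun x hx h => frontier_subset_distRegularSet hA hA' hAne (hAf x hx h)
  obtain ⟨η₂, h₂, H₂⟩ := hK.exists_pos_forall_le_imp_mem (isOpen_distRegularSet (A := B))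
    (continuous_signedInfDist B) hB0
    fun x hx h => frontier_subset_distRegularSet hB hB' hBne (hBf x hx h)
  obtain ⟨η₃, h₃, H₃⟩ := hK.exists_pos_forall_le_imp_mem
    (isOpen_thickening (δ := ε) (E := frontier A ∩ frontier B))
    ((continuous_signedInfDist A).max (continuous_signedInfDist B))
    (fun x hx => (hA0 x hx).trans (le_max_left _ _)) fun x hx h =>
      self_subset_thickening hε _ ⟨hAf x hx (le_antisymm ((le_max_left _ _).trans_eq h) (hA0 x hx)),
        hBf x hx (le_antisymm ((le_max_right _ _).trans_eq h) (hB0 x hx))⟩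
  refine ⟨min (min η₁ η₂) (min η₃ 1), by positivity,
    (min_le_right _ _).trans (min_le_right _ _), fun x hx => ⟨fun h => ?_, fun h => ?_,
    fun h h' => ?_⟩⟩
  · exact H₁ x hx (h.trans ((min_le_left _ _).trans (min_le_left _ _)))
  · exact H₂ x hx (h.trans ((min_le_left _ _).trans (min_le_right _ _)))
  · have := (min_le_right (min η₁ η₂) (min η₃ 1)).trans (min_le_left _ _)
    exact H₃ x hx (max_le (h.trans this) (h'.trans this))

variable {Ω : Set (EuclideanSpace ℝ (Fin n))} {x : EuclideanSpace ℝ (Fin n)}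
  {q : EuclideanSpace ℝ (Fin n) × ℝ} {f g : EuclideanSpace ℝ (Fin n) → ℝ}
  {R : Set (EuclideanSpace ℝ (Fin n))}

/-- The smoothed minimum is a defining function where its tangent majorant is noncritical. -/
theorem isLocalDefiningFunction_affineSmoothMin (hR : IsOpen R) (hf : ContDiffOn ℝ ∞ f R)
    (hg : ContDiffOn ℝ ∞ g R) (hx : x ∈ R) (hs : 0 < q.2 + inner ℝ q.1 x)
    (hΩ : ∀ z, 0 < q.2 + inner ℝ q.1 z → (z ∈ Ω ↔ 0 < affineSmoothMin q f g z))
    (hreg : ∀ t : ℝ, t = (f x - g x) / (q.2 + inner ℝ q.1 x) →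
      (1 / 2 - smoothHalfSign t) • gradient f x + (1 / 2 + smoothHalfSign t) • gradient g x -
        (smoothHalfAbs t - t * smoothHalfSign t) • q.1 ≠ 0) :
    IsLocalDefiningFunction Ω x (affineSmoothMin q f g) := by
  have hRS : IsOpen (R ∩ {z | 0 < q.2 + inner ℝ q.1 z}) := hR.inter (isOpen_affine_pos q)
  have hC : ContDiffOn ℝ ∞ (affineSmoothMin q f g) (R ∩ {z | 0 < q.2 + inner ℝ q.1 z}) :=
    contDiffOn_affineSmoothMin (hf.mono inter_subset_left) (hg.mono inter_subset_left)
      fun z hz => hz.2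
  have hxx : x ∈ R ∩ {z | 0 < q.2 + inner ℝ q.1 z} := ⟨hx, hs⟩
  have hfd := (hf.contDiffAt (hR.mem_nhds hx)).differentiableAt (by simp)
  have hgd := (hg.contDiffAt (hR.mem_nhds hx)).differentiableAt (by simp)
  obtain ⟨α, β, γ, t, ht, rfl, rfl, rfl, heq, hle⟩ := affineSmoothMin_touching (f := f) (g := g) hs
  have htend : Tendsto (fun v => x + v) (𝓝 0) (𝓝 x) := by
    have : Continuous fun v => x + v := by fun_prop
    simpa using this.tendsto 0
  have hgrad := fderiv_eq_of_touching
    ((hC.contDiffAt (hRS.mem_nhds hxx)).differentiableAt (by simp))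
    (hasFDerivAt_affineComb (1 / 2 - smoothHalfSign t) (1 / 2 + smoothHalfSign t)
      (smoothHalfAbs t - t * smoothHalfSign t) q hfd hgd).differentiableAt
    (htend.eventually hle) heq
  have hne : gradient (affineSmoothMin q f g) x ≠ 0 := by
    rw [gradient, hgrad]
    exact (gradient_affineComb _ _ _ q hfd hgd).trans_ne (hreg t ht)
  have hopen : IsOpen ((R ∩ {z | 0 < q.2 + inner ℝ q.1 z}) ∩
      gradient (affineSmoothMin q f g) ⁻¹' {v | v ≠ 0}) :=
    (hC.gradient hRS).continuousOn.isOpen_inter_preimage hRS isOpen_ne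
  exact ⟨_, hopen, ⟨hxx, hne⟩, hC.mono inter_subset_left, fun y hy => hy.2,
    fun y hy => hΩ y hy.1.2⟩

/-- The curvature condition for the zero set of the smoothed minimum. -/
theorem curvature_mem_of_affineSmoothMin {Γ : Set (Fin (n - 1) → ℝ)} (hΓ : IsCurvatureCone Γ)
    (hΩo : IsOpen Ω) (hR : IsOpen R) (hf : ContDiffOn ℝ ∞ f R)
    (hg : ContDiffOn ℝ ∞ g R) (hx : x ∈ R) (hs : 0 < q.2 + inner ℝ q.1 x)
    (hΩ : ∀ z, 0 < q.2 + inner ℝ q.1 z → (z ∈ Ω ↔ 0 < affineSmoothMin q f g z))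
    (hreg : ∀ t : ℝ, t = (f x - g x) / (q.2 + inner ℝ q.1 x) →
      (1 / 2 - smoothHalfSign t) • gradient f x + (1 / 2 + smoothHalfSign t) • gradient g x -
        (smoothHalfAbs t - t * smoothHalfSign t) • q.1 ≠ 0)
    (hxΩ : x ∈ frontier Ω) (h0 : affineSmoothMin q f g x = 0)
    (hfΓ : ∀ e : Fin (n - 1) → EuclideanSpace ℝ (Fin n), Orthonormal ℝ e →
      (fun i => -fderiv ℝ (fderiv ℝ f) x (e i) (e i)) ∈ Γ)
    (hgΓ : ∀ e : Fin (n - 1) → EuclideanSpace ℝ (Fin n), Orthonormal ℝ e →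
      (fun i => -fderiv ℝ (fderiv ℝ g) x (e i) (e i)) ∈ Γ)
    {κ : Fin (n - 1) → ℝ} (hκ : IsPrincipalCurvatures Ω x κ) : κ ∈ Γ := by
  obtain ⟨φ, ⟨U, hU, hxU, hφ, hφg, hφΩ⟩, e, he, hek⟩ := hκ
  have hfd := (hf.contDiffAt (hR.mem_nhds hx)).differentiableAt (by simp)
  have hgd := (hg.contDiffAt (hR.mem_nhds hx)).differentiableAt (by simp)
  obtain ⟨α, β, γ, t, ht, hα, hβ, hγ, heq, hle⟩ := affineSmoothMin_touching (f := f) (g := g) hs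
  have hφ2 : ContDiffAt ℝ 2 φ x := (hφ.contDiffAt (hU.mem_nhds hxU)).of_le two_le_infty
  have hL2 := ((contDiffOn_affineComb α β γ q hf hg).contDiffAt (hR.mem_nhds hx)).of_le two_le_infty
  have hLne : gradient (fun z => α * f z + β * g z - γ * (q.2 + inner ℝ q.1 z)) x ≠ 0 := by
    rw [gradient_affineComb α β γ q hfd hgd, hα, hβ, hγ]
    exact hreg t ht
  -- Comparing an arbitrary defining function directly with the majorant avoids second derivatives
  -- of the smoothed minimum.
  obtain ⟨r, hr, -, hD⟩ := exists_fderiv_eq_smul_of_pos_imp hφ2 hL2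
    (eq_zero_of_mem_frontier hΩo hU hφ.continuousOn hφΩ hxU hxΩ) (heq.symm.trans h0)
    (gradient_ne_zero_iff.1 (hφg x hxU)) (gradient_ne_zero_iff.1 hLne) (by
      filter_upwards [hle, hU.mem_nhds hxU, (isOpen_affine_pos q).mem_nhds hs] with z h1 h2 h3 h4
      exact ((hΩ z h3).1 ((hφΩ z h2).2 h4)).le.trans h1)
  have hmem : (fun i => α * -fderiv ℝ (fderiv ℝ f) x (e i) (e i) +
      β * -fderiv ℝ (fderiv ℝ g) x (e i) (e i)) ∈ Γ :=
    hΓ.convex (hfΓ e he) (hgΓ e he) (by linarith [smoothHalfSign_le t])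
      (by linarith [le_smoothHalfSign t]) (by linarith)
  have hnorm : 0 < ‖gradient φ x‖ := norm_pos_iff.2 (hφg x hxU)
  refine hΓ.mem_of_le (hΓ.smul_mem (‖gradient φ x‖⁻¹ * r⁻¹) (by positivity) _ hmem) fun i => ?_
  rw [curvature_eq_hessian hφ2 (hφg x hxU) (he.1 i) (hek i).1 (hek i).2]
  have h1 := hD (e i) (by rw [← inner_gradient_left]; exact (hek i).1)
  rw [hessian_affineComb α β γ q hR hf hg hx] at h1
  simp only [Pi.smul_apply, smul_eq_mul]
  rw [mul_assoc, ← mul_neg]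
  refine mul_le_mul_of_nonneg_left ?_ (by positivity)
  rw [inv_mul_le_iff₀ hr]
  linarith

/-- Smoothing of the intersection of two proper subsets. -/
theorem exists_smoothing {Γ : Set (Fin (n - 1) → ℝ)} (hΓ : IsCurvatureCone Γ)
    (hA : IsOpen A) (hB : IsOpen B) (hA' : HasSmoothBoundary A) (hB' : HasSmoothBoundary B)
    (hAne : A ≠ univ) (hBne : B ≠ univ) (hne : (A ∩ B).Nonempty)
    (hbd : Bornology.IsBounded (A ∩ B)) (hAΓ : PrincipalCurvaturesIn A Γ)
    (hBΓ : PrincipalCurvaturesIn B Γ) {ε : ℝ} (hε : 0 < ε) :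
    ∃ Ω : Set (EuclideanSpace ℝ (Fin n)), IsOpen Ω ∧ HasSmoothBoundary Ω ∧
      (A ∩ B) \ thickening ε (frontier A ∩ frontier B) ⊆ Ω ∧ Ω ⊆ A ∩ B ∧
      PrincipalCurvaturesIn Ω Γ := by
  have hn : 0 < n := by
    rcases Nat.eq_zero_or_pos n with rfl | h
    · exact absurd (Set.Nonempty.eq_univ (hne.mono inter_subset_left)) hAne
    · exact h
  set K := closure (A ∩ B) with hKdef
  have hK : IsCompact K := hbd.isCompact_closure
  have hKA : K ⊆ closure A := closure_mono inter_subset_left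
  have hKB : K ⊆ closure B := closure_mono inter_subset_right
  obtain ⟨CA, hCA⟩ := hA'.exists_hessian_bound hA hAne hK
  obtain ⟨CB, hCB⟩ := hB'.exists_hessian_bound hB hBne hK
  obtain ⟨η, hη, hη1, hscale⟩ := exists_smoothing_scale hA hB hA' hB' hAne hBne hK hKA hKB hε
  set c := max 1 (max CA CB) with hc
  have hc0 : 0 < c := lt_of_lt_of_le one_pos (le_max_left _ _)
  have hcA : CA ≤ c := (le_max_left _ _).trans (le_max_right _ _)
  have hcB : CB ≤ c := (le_max_right _ _).trans (le_max_right _ _)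
  -- The value of `f` and `g` at signed distance `η`: values at most `μ` mean distance at most `η`.
  set μ := 1 - Real.exp (-c * η) with hμdef
  have hμ : 0 < μ := by
    rw [hμdef, sub_pos, Real.exp_lt_one_iff]
    nlinarith
  obtain ⟨M, hM1, hM⟩ := hK.isBounded.exists_pos_norm_le
  set f := expDist A c with hf
  set g := expDist B c with hg
  set R := distRegularSet A ∩ distRegularSet B with hR
  have hRo : IsOpen R := isOpen_distRegularSet.inter isOpen_distRegularSet
  have hfR : ContDiffOn ℝ ∞ f R := (contDiffOn_expDist c).mono inter_subset_left
  have hgR : ContDiffOn ℝ ∞ g R := (contDiffOn_expDist c).mono inter_subset_right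
  have hfc : Continuous f := continuous_expDist c
  have hgc : Continuous g := continuous_expDist c
  -- On `K` the linear part is at most `μ / 4` in absolute value, so the smoothing parameter stays
  -- between `μ / 12` and `3 * μ / 4`.
  obtain ⟨q, ⟨hq1, hq2⟩, hq⟩ := exists_regular_parameter hfc hgc hRo hfR hgR
    (O := ball 0 (μ / (4 * M)) ×ˢ Ioo (μ / 3) (μ / 2)) (isOpen_ball.prod isOpen_Ioo)
    ⟨(0, 5 * μ / 12), mem_ball_self (by positivity), by constructor <;> linarith⟩
  have hsK : ∀ x ∈ K, 0 < q.2 + inner ℝ q.1 x ∧ q.2 + inner ℝ q.1 x < μ := by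
    intro x hx
    have h1 : |inner ℝ q.1 x| ≤ μ / 4 := by
      refine (abs_real_inner_le_norm q.1 x).trans ?_
      have h2 : ‖q.1‖ ≤ μ / (4 * M) := (mem_ball_zero_iff.1 hq1).le
      calc ‖q.1‖ * ‖x‖ ≤ μ / (4 * M) * M :=
            mul_le_mul h2 (hM x hx) (norm_nonneg _) (by positivity)
        _ = μ / 4 := by field_simp
    obtain ⟨h3, h4⟩ := abs_le.1 h1
    obtain ⟨h5, h6⟩ := hq2
    constructor <;> linarith
  set Ω := (A ∩ B) ∩ affineSmoothMin q f g ⁻¹' Ioi 0 with hΩdef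
  have hΩo : IsOpen Ω :=
    ((continuousOn_affineSmoothMin hfc hgc).mono fun z hz =>
      (hsK z (subset_closure hz)).1).isOpen_inter_preimage (hA.inter hB) isOpen_Ioi
  have hΩ : ∀ z, 0 < q.2 + inner ℝ q.1 z → (z ∈ Ω ↔ 0 < affineSmoothMin q f g z) := by
    intro z hz
    refine ⟨fun h => h.2, fun h => ⟨⟨?_, ?_⟩, h⟩⟩
    · exact (expDist_pos_iff hc0 hA hAne).1 (h.trans_le (smoothMin_le_left hz))
    · exact (expDist_pos_iff hc0 hB hBne).1 (h.trans_le (smoothMin_le_right hz))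
  have hsmall : ∀ x ∈ K, |f x - g x| ≤ q.2 + inner ℝ q.1 x → affineSmoothMin q f g x ≤ 0 →
      signedInfDist A x ≤ η ∧ signedInfDist B x ≤ η := by
    intro x hx h1 h2
    obtain ⟨hs0, hs1⟩ := hsK x hx
    have h3 := add_le_of_smoothMin_nonpos hs0 h1 h2
    have h4 : 0 ≤ f x := expDist_nonneg hc0 (signedInfDist_nonneg_of_mem_closure (hKA hx))
    have h5 : 0 ≤ g x := expDist_nonneg hc0 (signedInfDist_nonneg_of_mem_closure (hKB hx))
    exact ⟨signedInfDist_le_of_expDist_le (A := A) hc0 (by linarith),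
      signedInfDist_le_of_expDist_le (A := B) hc0 (by linarith)⟩
  have hΩK : frontier Ω ⊆ K := frontier_subset_closure.trans (closure_mono inter_subset_left)
  have hcases : ∀ x ∈ frontier Ω, (∀ᶠ z in 𝓝 x, z ∈ Ω ↔ z ∈ A) ∨ (∀ᶠ z in 𝓝 x, z ∈ Ω ↔ z ∈ B) ∨
      |f x - g x| ≤ q.2 + inner ℝ q.1 x := by
    intro x hx
    have hpos := (isOpen_affine_pos q).mem_nhds (hsK x (hΩK hx)).1
    have hsc : Continuous fun z : EuclideanSpace ℝ (Fin n) => q.2 + inner ℝ q.1 z := by fun_prop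
    by_cases h1 : q.2 + inner ℝ q.1 x < g x - f x
    · left
      filter_upwards [hpos, (isOpen_lt hsc (hgc.sub hfc)).mem_nhds h1] with z hz hz'
      rw [hΩ z hz, affineSmoothMin, smoothMin_eq_left hz (le_of_lt hz')]
      exact expDist_pos_iff hc0 hA hAne
    by_cases h2 : q.2 + inner ℝ q.1 x < f x - g x
    · right; left
      filter_upwards [hpos, (isOpen_lt hsc (hfc.sub hgc)).mem_nhds h2] with z hz hz'
      rw [hΩ z hz, affineSmoothMin, smoothMin_eq_right hz (le_of_lt hz')]
      exact expDist_pos_iff hc0 hB hBne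
    · right; right
      rw [abs_le]
      constructor <;> linarith
  have hzero : ∀ x ∈ frontier Ω, affineSmoothMin q f g x = 0 := fun x hx =>
    eq_zero_of_mem_frontier hΩo (isOpen_affine_pos q) (continuousOn_affineSmoothMin hfc hgc)
      (fun z hz => hΩ z hz) (hsK x (hΩK hx)).1 hx
  have hmixed : ∀ x ∈ frontier Ω, |f x - g x| ≤ q.2 + inner ℝ q.1 x → x ∈ R ∧
      ∀ t : ℝ, t = (f x - g x) / (q.2 + inner ℝ q.1 x) →
        (1 / 2 - smoothHalfSign t) • gradient f x + (1 / 2 + smoothHalfSign t) • gradient g x -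
          (smoothHalfAbs t - t * smoothHalfSign t) • q.1 ≠ 0 := by
    intro x hx hle
    have hxK := hΩK hx
    have hs0 := (hsK x hxK).1
    obtain ⟨hηA, hηB⟩ := hsmall x hxK hle (hzero x hx).le
    have hxA : x ∈ distRegularSet A := (hscale x hxK).1 hηA
    have hxB : x ∈ distRegularSet B := (hscale x hxK).2.1 hηB
    refine ⟨⟨hxA, hxB⟩, fun t ht => ?_⟩
    -- Genericity covers only the open rounding zone. On its edge `t = ±1` the intercept vanishes
    -- and the combination is the gradient of `g` or `f` alone.
    rcases hle.lt_or_eq with hlt | heq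
    · exact hq x ⟨hxA, hxB⟩ _ t rfl ht hs0 hlt (hzero x hx)
    · rcases eq_or_eq_neg_of_abs_eq heq with h | h
      · have ht1 : t = 1 := by rw [ht, h, div_self hs0.ne']
        rw [ht1, smoothHalfSign_of_one_le le_rfl, smoothHalfAbs_of_one_le le_rfl]
        have := gradient_expDist_ne_zero hc0 hxB
        norm_num
        exact this
      · have ht1 : t = -1 := by rw [ht, h, neg_div, div_self hs0.ne']
        rw [ht1, smoothHalfSign_of_le_neg_one le_rfl, smoothHalfAbs_of_le_neg_one le_rfl]
        have := gradient_expDist_ne_zero hc0 hxA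
        norm_num
        exact this
  refine ⟨Ω, hΩo, fun x hx => ?_, ?_, inter_subset_left, fun x hx κ hκ => ?_⟩
  · rcases hcases x hx with h | h | h
    · obtain ⟨φ, hφ⟩ := hA' x (mem_frontier_congr h hx)
      exact ⟨φ, hφ.congr (h.mono fun z hz => hz.symm)⟩
    · obtain ⟨φ, hφ⟩ := hB' x (mem_frontier_congr h hx)
      exact ⟨φ, hφ.congr (h.mono fun z hz => hz.symm)⟩
    · obtain ⟨hxR, hreg⟩ := hmixed x hx h
      exact ⟨_, isLocalDefiningFunction_affineSmoothMin hRo hfR hgR hxR (hsK x (hΩK hx)).1 hΩ hreg⟩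
  · rintro x ⟨hxAB, hxε⟩
    have hxK : x ∈ K := subset_closure hxAB
    have hs0 := (hsK x hxK).1
    rw [hΩ x hs0]
    by_contra! hle
    have hfx : 0 < f x := (expDist_pos_iff hc0 hA hAne).2 hxAB.1
    have hgx : 0 < g x := (expDist_pos_iff hc0 hB hBne).2 hxAB.2
    have habs : |f x - g x| ≤ q.2 + inner ℝ q.1 x := by
      rw [abs_le]
      constructor
      · by_contra! h
        rw [affineSmoothMin, smoothMin_eq_left hs0 (by linarith)] at hle
        linarith
      · by_contra! h
        rw [affineSmoothMin, smoothMin_eq_right hs0 (by linarith)] at hle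
        linarith
    obtain ⟨h1, h2⟩ := hsmall x hxK habs hle
    exact hxε ((hscale x hxK).2.2 h1 h2)
  · rcases hcases x hx with h | h | h
    · exact hAΓ x (mem_frontier_congr h hx) κ (hκ.congr h)
    · exact hBΓ x (mem_frontier_congr h hx) κ (hκ.congr h)
    · obtain ⟨hxR, hreg⟩ := hmixed x hx h
      have hxK := hΩK hx
      obtain ⟨hηA, hηB⟩ := hsmall x hxK h (hzero x hx).le
      refine curvature_mem_of_affineSmoothMin hΓ hΩo hRo hfR hgR hxR (hsK x hxK).1 hΩ hreg hx
        (hzero x hx) (fun e he => ?_) (fun e he => ?_) hκ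
      · exact hessian_expDist_mem hΓ hn hA hA' hAne hAΓ hc0 hxR.1 (hKA hxK)
          (fun y hy hxy => (hCA x hxK y hy (by linarith)).trans hcA) he
      · exact hessian_expDist_mem hΓ hn hB hB' hBne hBΓ hc0 hxR.2 (hKB hxK)
          (fun y hy hxy => (hCB x hxK y hy (by linarith)).trans hcB) he

theorem isCurvatureCone_univ {m : ℕ} : IsCurvatureCone (univ : Set (Fin m → ℝ)) where
  isOpen_or_isClosed := Or.inl isOpen_univ
  convex := convex_univ
  smul_mem _ _ _ _ := mem_univ _
  symmetric _ _ _ := mem_univ _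
  pos_mem _ _ := mem_univ _

end Main

theorem theorem1p2 (n : ℕ) (A B : Set (EuclideanSpace ℝ (Fin n)))
    (hA : IsOpen A) (hB : IsOpen B)
    (hA' : HasSmoothBoundary A) (hB' : HasSmoothBoundary B)
    (hne : (A ∩ B).Nonempty) (hbd : Bornology.IsBounded (A ∩ B)) :
    (∀ ε : ℝ, 0 < ε → ∃ Ω : Set (EuclideanSpace ℝ (Fin n)),
      IsOpen Ω ∧ HasSmoothBoundary Ω ∧
      (A ∩ B) \ Metric.thickening ε (frontier A ∩ frontier B) ⊆ Ω ∧ Ω ⊆ A ∩ B) ∧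
    (∀ Γ : Set (Fin (n - 1) → ℝ), IsCurvatureCone Γ →
      PrincipalCurvaturesIn A Γ → PrincipalCurvaturesIn B Γ →
      ∀ ε : ℝ, 0 < ε → ∃ Ω : Set (EuclideanSpace ℝ (Fin n)),
        IsOpen Ω ∧ HasSmoothBoundary Ω ∧
        (A ∩ B) \ Metric.thickening ε (frontier A ∩ frontier B) ⊆ Ω ∧ Ω ⊆ A ∩ B ∧
        PrincipalCurvaturesIn Ω Γ) := by
  have main : ∀ Γ : Set (Fin (n - 1) → ℝ), IsCurvatureCone Γ →
      PrincipalCurvaturesIn A Γ → PrincipalCurvaturesIn B Γ →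
      ∀ ε : ℝ, 0 < ε → ∃ Ω : Set (EuclideanSpace ℝ (Fin n)),
        IsOpen Ω ∧ HasSmoothBoundary Ω ∧
        (A ∩ B) \ Metric.thickening ε (frontier A ∩ frontier B) ⊆ Ω ∧ Ω ⊆ A ∩ B ∧
        PrincipalCurvaturesIn Ω Γ := by
    intro Γ hΓ hAΓ hBΓ ε hε
    -- The signed distance of the whole space is identically zero, so this case is separate; the
    -- other set itself serves as `Ω`.
    by_cases hAne : A = univ
    · subst hAne
      rw [univ_inter]
      exact ⟨B, hB, hB', sdiff_subset, subset_rfl, hBΓ⟩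
    by_cases hBne : B = univ
    · subst hBne
      rw [inter_univ]
      exact ⟨A, hA, hA', sdiff_subset, subset_rfl, hAΓ⟩
    exact exists_smoothing hΓ hA hB hA' hB' hAne hBne hne hbd hAΓ hBΓ hε
  refine ⟨fun ε hε => ?_, main⟩
  obtain ⟨Ω, h1, h2, h3, h4, -⟩ := main univ isCurvatureCone_univ (fun _ _ _ _ => mem_univ _)
    (fun _ _ _ _ => mem_univ _) ε hε
  exact ⟨Ω, h1, h2, h3, h4⟩
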